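/- For $n\ge 1$ let $\mathfrak h$ be the complex vector space with basis $\beta^1,\dots,\beta^n,\alpha^1,\dots,\alpha^n$ and the symmetric bilinear form for which this basis is orthonormal, and let $M(1)$ be the associated Heisenberg vertex operator algebra of level $1$. That is, $M(1)$ is the symmetric algebra $\mathbb C[h(-m)\mid h \text{ in the basis},\ m\ge 1]$ with vacuum $\mathbf 1=1$; for a basis vector $h$, the operator $h(-m)$ ($m\ge1$) acts by multiplication, $h(m)=m\,\partial/\partial h(-m)$ for $m\ge 1$, $h(0)=0$, and $h(z)=\sum_{m\in\mathbb Z}h(m)z^{-m-1}$; for basis vectors $h_1,\dots,h_k$ and integers $m_1,\dots,m_k\ge1$, the vertex operator of $v=h_1(-m_1)\cdots h_k(-m_k)\mathbf 1$ is the normally ordered product $$Y(v,z)=\sum_{p\in\mathbb Z}v_pz^{-p-1}={}^{\circ}_{\circ}\prod_{j=1}^k\frac{1}{(m_j-1)!}\Big(\frac{d}{dz}\Big)^{m_j-1}h_j(z)\,{}^{\circ}_{\circ},$$ extended linearly to all $v\in M(1)$, where normal ordering places the operators $h(m)$ with $m<0$ to the left of those with $m\ge 0$. Let $C_2(M(1))=\operatorname{span}_{\mathbb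 C}\{u_{-2}v\mid u,v\in M(1)\}$ and, identifying $h\in\mathfrak h$ with $h(-1)\mathbf 1$, let $f_i=\beta^i_{1}-\alpha^i_{-1}:M(1)\to M(1)$ for $1\le i\le n$. For a subspace $M$ of a vertex algebra $V$, let $r_{0,-1}(M)$ be the set of $v\in V$ for which there is $m\ge 0$ such that $v_{n_1}\cdots v_{n_t}v\in M$ for all $t\ge m$ and $n_1,\dots,n_t\in\{0,-1\}$. Let $sr_{0,-1}(M)$ be the set of $v\in V$ such that for every $b\in V$ there is $m\ge0$ such that both $b_s(v_{n_1}\cdots v_{n_t}v)\in M$ and $(v_{n_1}\cdots v_{n_t}v)_s b\in M$ for all $t\ge m$ and $s,n_1,\dots,n_t\in\{0,-1\}$. Call $M$ an $MZ_{0,-1}$-subspace of $V$ if $r_{0,-1}(M)=sr_{0,-1}(M)$. Suppose that for every $n\ge 1$ the subspace $\sum_{i=1}^n f_i(M(1))+C_2(M(1))$ is an $MZ_{0,-1}$-subspace of $M(1)$. Then the Jacobian conjecture holds in every dimension: for every positive integer $n$, every $\mathbb C$-algebra endomorphism $\phi$ of $\mathbb C[x_1,\dots,x_n]$ with $\det\left(\frac{\partial\phi(x_i)}{\partial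 x_j}\right)_{1\le i,j\le n}=1$ is an automorphism. -/

import Mathlib

noncomputable section

/-! ### Mathieu-Zhao subspaces with respect to the `0`-th and `(-1)`-st products -/

namespace MZVertex

variable {V : Type*} [AddCommGroup V] [Module ℂ V]

/-- The `n`-th product: `nthMode Y v n` is the endomorphism `v_n` in
`Y(v, z) = ∑ v_n z^(-n-1)`. -/
def nthMode (Y : V →ₗ[ℂ] VertexOperator ℂ V) (v : V) (n : ℤ) : Module.End ℂ V :=
  VertexOperator.ncoeff (Y v) n

/-- `C₂(V)`, the linear span of all `u_{-2} v`. -/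
def cTwo (Y : V →ₗ[ℂ] VertexOperator ℂ V) : Submodule ℂ V :=
  Submodule.span ℂ {x | ∃ u v : V, x = nthMode Y u (-2) v}

/-- For `L = [n₁, …, n_t]` the vector `v_{n₁} v_{n₂} ⋯ v_{n_t} v`. -/
def iterProd (Y : V →ₗ[ℂ] VertexOperator ℂ V) (v : V) (L : List ℤ) : V :=
  L.foldr (fun n a => nthMode Y v n a) v

/-- All entries of the list are `0` or `-1`. -/
def IsZeroNegOne (L : List ℤ) : Prop := ∀ n ∈ L, n = 0 ∨ n = -1

/-- The radical `r_{0,-1}(M)`. -/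
def radical (Y : V →ₗ[ℂ] VertexOperator ℂ V) (M : Submodule ℂ V) : Set V :=
  {v | ∃ m : ℕ, ∀ L : List ℤ, IsZeroNegOne L → m ≤ L.length → iterProd Y v L ∈ M}

/-- The left-strong radical `lsr_{0,-1}(M)`. -/
def leftStrongRadical (Y : V →ₗ[ℂ] VertexOperator ℂ V) (M : Submodule ℂ V) : Set V :=
  {v | ∀ b : V, ∃ m : ℕ, ∀ L : List ℤ, IsZeroNegOne L → m ≤ L.length →
    ∀ s : ℤ, s = 0 ∨ s = -1 → nthMode Y b s (iterProd Y v L) ∈ M}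

/-- The right-strong radical `rsr_{0,-1}(M)`. -/
def rightStrongRadical (Y : V →ₗ[ℂ] VertexOperator ℂ V) (M : Submodule ℂ V) : Set V :=
  {v | ∀ w : V, ∃ m : ℕ, ∀ L : List ℤ, IsZeroNegOne L → m ≤ L.length →
    ∀ n : ℤ, n = 0 ∨ n = -1 → nthMode Y (iterProd Y v L) n w ∈ M}

/-- The strong radical `sr_{0,-1}(M)`. -/
def strongRadical (Y : V →ₗ[ℂ] VertexOperator ℂ V) (M : Submodule ℂ V) : Set V :=
  leftStrongRadical Y M ∩ rightStrongRadical Y M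

/-- `M` is an `MZ_{0,-1}`-subspace: `r_{0,-1}(M) = sr_{0,-1}(M)`. -/
def IsMZSubspace (Y : V →ₗ[ℂ] VertexOperator ℂ V) (M : Submodule ℂ V) : Prop :=
  radical Y M = strongRadical Y M

end MZVertex

/-! ### The Heisenberg vertex operator algebra `M(1)` -/

namespace Heisenberg

open MvPolynomial

variable {ι : Type*}

/-- The Fock space `M(1)` of the vector space `𝔥` with orthonormal basis `(h_i)_{i : ι}`,
realized as the symmetric algebra on `t⁻¹𝔥[t⁻¹]`: the variable `X (i, n)`, `n ≥ 1`,
is `h_i(-n) 𝟏`, and the vacuum `𝟏` is the polynomial `1`. -/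
abbrev Fock (ι : Type*) : Type _ := MvPolynomial (ι × ℕ+) ℂ

/-- The operator `h_i(m) = h_i ⊗ t^m` on `M(1)`. For `m < 0` it is multiplication by
`X (i, -m)`, for `m > 0` it is `m ∂/∂X (i, m)`, and `h_i(0) = 0`. These satisfy
`[h_i(m), h_j(n)] = m δ_{i,j} δ_{m+n,0}`. -/
def mode (i : ι) : ℤ → Module.End ℂ (Fock ι)
  | Int.ofNat 0 => 0
  | Int.ofNat (k + 1) => ((k : ℂ) + 1) • (pderiv (R := ℂ) (i, k.succPNat)).toLinearMap
  | Int.negSucc k => LinearMap.mulLeft ℂ (X (i, k.succPNat) : Fock ι)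

/-- The normally ordered product of the operators `h_i(m)`, `(i, m)` in the list: the operators
with `m < 0` are placed to the left of those with `0 ≤ m`. -/
def normalOrder (L : List (ι × ℤ)) : Module.End ℂ (Fock ι) :=
  ((L.filter (fun a => a.2 < 0) ++ L.filter (fun a => 0 ≤ a.2)).map
    (fun a => mode a.1 a.2)).prod

/-- The coefficient of `h(m) z^(-m-n)` in `(1/(n-1)!) (d/dz)^(n-1) h(z)`, where
`h(z) = ∑ h(m) z^(-m-1)`; it is the generalized binomial coefficient of `-m-1` over `n-1`. -/
def fieldCoeff (n : ℕ+) (m : ℤ) : ℂ := ((Ring.choose (-m - 1) n.natPred : ℤ) : ℂ)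

/-- For `l = [(i₁, n₁), …, (i_k, n_k)]` and `m = (m₁, …, m_k)`, the contribution of the modes
`h_{i_j}(m_j)` to the normally ordered product of the fields
`(1/(n_j-1)!) (d/dz)^(n_j-1) h_{i_j}(z)`. -/
def fieldTerm (l : List (ι × ℕ+)) (m : Fin l.length → ℤ) : Module.End ℂ (Fock ι) :=
  (∏ j, fieldCoeff (l.get j).2 (m j)) • normalOrder (List.ofFn fun j => ((l.get j).1, m j))

/-- The mode tuples which contribute to the coefficient of `z^k`. -/
def modeTuples (l : List (ι × ℕ+)) (k : ℤ) : Set (Fin l.length → ℤ) :=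
  {m | ∑ j, (-m j - ((l.get j).2 : ℤ)) = k}

theorem exists_bound (w : Fock ι) :
    ∃ N : ℕ, w ∈ supported ℂ {q : ι × ℕ+ | (q.2 : ℕ) < N} := by
  refine ⟨w.vars.sup (fun q => (q.2 : ℕ)) + 1, ?_⟩
  rw [mem_supported]
  intro q hq
  exact Nat.lt_succ_of_le (Finset.le_sup (f := fun q : ι × ℕ+ => (q.2 : ℕ)) hq)

theorem pderiv_mem_supported (s : Set (ι × ℕ+)) (q : ι × ℕ+) {w : Fock ι}
    (hw : w ∈ supported ℂ s) : pderiv q w ∈ supported ℂ s := by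
  classical
  rw [supported] at hw
  induction hw using Algebra.adjoin_induction with
  | mem x hx =>
    obtain ⟨y, _, rfl⟩ := hx
    rw [pderiv_X, Pi.single_apply]
    split_ifs
    · exact one_mem _
    · exact zero_mem _
  | algebraMap r => simp [algebraMap_eq]
  | add x y _ _ hx hy => rw [map_add]; exact add_mem hx hy
  | mul x y hx' hy' hx hy =>
    rw [pderiv_mul]
    exact add_mem (mul_mem hx hy') (mul_mem hx' hy)

theorem mode_mem_supported (s : Set (ι × ℕ+)) (i : ι) {m : ℤ} (hm : 0 ≤ m) {w : Fock ι}
    (hw : w ∈ supported ℂ s) : mode i m w ∈ supported ℂ s := by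
  match m, hm with
  | Int.ofNat 0, _ => simp [mode]
  | Int.ofNat (k + 1), _ =>
    exact Subalgebra.smul_mem _ (pderiv_mem_supported s _ hw) _

theorem mode_eq_zero (i : ι) {N : ℕ} {m : ℤ} (hm : (N : ℤ) ≤ m) {w : Fock ι}
    (hw : w ∈ supported ℂ {q : ι × ℕ+ | (q.2 : ℕ) < N}) : mode i m w = 0 := by
  match m, hm with
  | Int.ofNat 0, _ => simp [mode]
  | Int.ofNat (k + 1), hm =>
    have h : pderiv (R := ℂ) (i, k.succPNat) w = 0 := by
      apply pderiv_eq_zero_of_notMem_vars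
      intro hv
      have := mem_supported.1 hw hv
      simp only [Set.mem_ofPred_eq, Nat.succPNat_coe] at this
      have h2 : (N : ℤ) ≤ ((k + 1 : ℕ) : ℤ) := hm
      omega
    simp [mode, h]
  | Int.negSucc k, hm => exact absurd hm (by have := Int.negSucc_lt_zero k; omega)

theorem prod_mode_mem (s : Set (ι × ℕ+)) {w : Fock ι} (hw : w ∈ supported ℂ s)
    (L : List (ι × ℤ)) (hL : ∀ a ∈ L, 0 ≤ a.2) :
    (L.map (fun a => mode a.1 a.2)).prod w ∈ supported ℂ s := by
  induction L with
  | nil => simpa using hw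
  | cons a L ih =>
    simp only [List.map_cons, List.prod_cons, Module.End.mul_apply]
    exact mode_mem_supported s _ (hL a (by simp)) (ih fun b hb => hL b (by simp [hb]))

theorem prod_mode_eq_zero {N : ℕ} {w : Fock ι}
    (hw : w ∈ supported ℂ {q : ι × ℕ+ | (q.2 : ℕ) < N})
    (L : List (ι × ℤ)) (hL : ∀ a ∈ L, 0 ≤ a.2) (h : ∃ a ∈ L, (N : ℤ) ≤ a.2) :
    (L.map (fun a => mode a.1 a.2)).prod w = 0 := by
  induction L with
  | nil => simp at h
  | cons a L ih =>
    simp only [List.map_cons, List.prod_cons, Module.End.mul_apply]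
    have hL' : ∀ b ∈ L, 0 ≤ b.2 := fun b hb => hL b (by simp [hb])
    obtain ⟨b, hb, hbN⟩ := h
    rcases List.mem_cons.1 hb with rfl | hb
    · exact mode_eq_zero _ hbN (prod_mode_mem _ hw L hL')
    · rw [ih hL' ⟨b, hb, hbN⟩, map_zero]

theorem normalOrder_eq_zero {N : ℕ} {w : Fock ι}
    (hw : w ∈ supported ℂ {q : ι × ℕ+ | (q.2 : ℕ) < N})
    (L : List (ι × ℤ)) (h : ∃ a ∈ L, (N : ℤ) ≤ a.2) : normalOrder L w = 0 := by
  obtain ⟨a, ha, haN⟩ := h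
  have h0 : (0 : ℤ) ≤ a.2 := le_trans (by positivity) haN
  rw [normalOrder, List.map_append, List.prod_append, Module.End.mul_apply,
    prod_mode_eq_zero hw _ (by simp) ⟨a, by simp [ha, h0], haN⟩, map_zero]

theorem fieldCoeff_eq_zero {n : ℕ+} {m : ℤ} (hm : m < 0) (h : -(n : ℤ) < m) :
    fieldCoeff n m = 0 := by
  obtain ⟨k, rfl⟩ := Int.eq_negSucc_of_lt_zero hm
  have h1 : -Int.negSucc k - 1 = (k : ℤ) := by rw [Int.neg_negSucc]; push_cast; ring
  have h2 : k < n.natPred := by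
    have := PNat.natPred_add_one n
    omega
  rw [fieldCoeff, h1, Ring.choose_natCast, Nat.choose_eq_zero_of_lt h2]
  simp

theorem fieldTerm_ne_zero {N : ℕ} {w : Fock ι}
    (hw : w ∈ supported ℂ {q : ι × ℕ+ | (q.2 : ℕ) < N})
    {l : List (ι × ℕ+)} {m : Fin l.length → ℤ} (h : fieldTerm l m w ≠ 0) (j : Fin l.length) :
    m j < N ∧ (m j < 0 → m j ≤ -((l.get j).2 : ℤ)) := by
  constructor
  · by_contra hj
    refine h ?_
    rw [fieldTerm, LinearMap.smul_apply, normalOrder_eq_zero hw _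
      ⟨((l.get j).1, m j), by rw [List.mem_ofFn]; exact ⟨j, rfl⟩, not_lt.1 hj⟩, smul_zero]
  · intro hneg
    by_contra hj
    refine h ?_
    rw [fieldTerm, LinearMap.smul_apply,
      Finset.prod_eq_zero (Finset.mem_univ j) (fieldCoeff_eq_zero hneg (not_le.1 hj)), zero_smul]

theorem finite_support (l : List (ι × ℕ+)) (k : ℤ) (w : Fock ι) :
    (modeTuples l k ∩ Function.support fun m => fieldTerm l m w).Finite := by
  obtain ⟨N, hN⟩ := exists_bound w
  refine (Set.finite_Icc (fun j : Fin l.length => -k - ((l.get j).2 : ℤ) -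
    ∑ _i : Fin l.length, ((N : ℤ) + ∑ i, ((l.get i).2 : ℤ))) (fun _ => (N : ℤ))).subset ?_
  rintro m ⟨hm, hs⟩
  have hb := fun j => (fieldTerm_ne_zero hN hs j).1
  refine ⟨fun j => ?_, fun j => (hb j).le⟩
  simp only [modeTuples, Set.mem_ofPred_eq] at hm
  rw [← Finset.add_sum_erase _ _ (Finset.mem_univ j)] at hm
  have h1 : ∑ i ∈ Finset.univ.erase j, (m i + ((l.get i).2 : ℤ)) ≤
      ∑ _i : Fin l.length, ((N : ℤ) + ∑ i, ((l.get i).2 : ℤ)) := by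
    refine (Finset.sum_le_sum (g := fun _ => (N : ℤ) + ∑ i, ((l.get i).2 : ℤ)) ?_).trans
      (Finset.sum_le_sum_of_subset_of_nonneg (Finset.subset_univ _) fun _ _ _ => by positivity)
    intro i _
    have := Finset.single_le_sum (f := fun i => ((l.get i).2 : ℤ)) (fun _ _ => by positivity)
      (Finset.mem_univ i)
    have := hb i
    linarith
  have h2 : ∑ i ∈ Finset.univ.erase j, (-m i - ((l.get i).2 : ℤ)) =
      -∑ i ∈ Finset.univ.erase j, (m i + ((l.get i).2 : ℤ)) := by
    rw [← Finset.sum_neg_distrib]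
    exact Finset.sum_congr rfl fun _ _ => by ring
  simp only at *
  linarith

/-- The coefficient of `z^k` in the normally ordered product of the fields
`(1/(n_j-1)!) (d/dz)^(n_j-1) h_{i_j}(z)`, `(i_j, n_j)` in the list `l`. Applied to a vector, only
finitely many terms of the sum are nonzero. -/
def zCoeff (l : List (ι × ℕ+)) (k : ℤ) : Module.End ℂ (Fock ι) where
  toFun w := ∑ᶠ m ∈ modeTuples l k, fieldTerm l m w
  map_add' u w := by
    simp only [map_add]
    exact finsum_mem_add_distrib' (finite_support l k u) (finite_support l k w)
  map_smul' c w := by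
    simp only [map_smul, RingHom.id_apply]
    exact ((DistribSMul.toAddMonoidHom (Fock ι) c).map_finsum_mem'
      (finite_support l k w)).symm

theorem bddBelow_zCoeff (l : List (ι × ℕ+)) (w : Fock ι) :
    BddBelow (Function.support fun k => zCoeff l k w) := by
  obtain ⟨N, hN⟩ := exists_bound w
  refine ⟨∑ j, (-(N : ℤ) - ((l.get j).2 : ℤ)), fun k hk => ?_⟩
  by_contra hlt
  refine hk (finsum_mem_eq_zero_of_forall_eq_zero fun m hm => ?_)
  by_contra hne
  refine hlt ?_
  rw [← show _ = k from hm]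
  exact Finset.sum_le_sum fun j _ => by
    have := (fieldTerm_ne_zero hN hne j).1
    linarith

/-- The vertex operator of the monomial `h_{i₁}(-n₁) ⋯ h_{i_k}(-n_k) 𝟏`, with
`l = [(i₁, n₁), …, (i_k, n_k)]`: the normally ordered product of the fields
`(1/(n_j-1)!) (d/dz)^(n_j-1) h_{i_j}(z)`. -/
def monomialField (l : List (ι × ℕ+)) : VertexOperator ℂ (Fock ι) :=
  VertexOperator.of_coeff (zCoeff l) (bddBelow_zCoeff l)

/-- The vertex operator map `v ↦ Y(v, z)` of `M(1)`, extended linearly from the monomials. The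
order in which the variables of a monomial are listed is irrelevant, since the `h_i(m)` with
`m < 0` commute with each other, and so do those with `0 ≤ m`. -/
def Y (ι : Type*) : Fock ι →ₗ[ℂ] VertexOperator ℂ (Fock ι) :=
  (basisMonomials (ι × ℕ+) ℂ).constr ℂ fun s => monomialField (Finsupp.toMultiset s).toList

/-- The vector `h_i(-1) 𝟏` of `M(1)`, identified with `h_i`. -/
def gen (i : ι) : Fock ι := X (i, 1)

/-- Let `𝔥` have the orthonormal basis `β¹, …, βⁿ, α¹, …, αⁿ`, where `β^i` is indexed by
`Sum.inl i` and `α^i` by `Sum.inr i`. This is the map `f_i = β^i_1 - α^i_{-1}` on `M(1)`. -/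
def fMap {n : ℕ} (i : Fin n) : Module.End ℂ (Fock (Fin n ⊕ Fin n)) :=
  MZVertex.nthMode (Y (Fin n ⊕ Fin n)) (gen (Sum.inl i)) 1 -
    MZVertex.nthMode (Y (Fin n ⊕ Fin n)) (gen (Sum.inr i)) (-1)

/-- The subspace `∑_{i=1}^n f_i(M(1)) + C₂(M(1))` of `M(1)`. -/
def imageSubspace (n : ℕ) : Submodule ℂ (Fock (Fin n ⊕ Fin n)) :=
  (⨆ i : Fin n, LinearMap.range (fMap i)) ⊔ MZVertex.cTwo (Y (Fin n ⊕ Fin n))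

end Heisenberg

/-- The Jacobian matrix `(∂φ(x_i)/∂x_j)` of an endomorphism `φ` of `ℂ[x₁, …, x_n]`. -/
def jacobianMatrix {n : ℕ} (φ : MvPolynomial (Fin n) ℂ →ₐ[ℂ] MvPolynomial (Fin n) ℂ) :
    Matrix (Fin n) (Fin n) (MvPolynomial (Fin n) ℂ) :=
  Matrix.of fun i j => MvPolynomial.pderiv j (φ (MvPolynomial.X i))

end

/-!
Modulo `C₂(M(1))` the products `u_{-1} v` and `u_0 v` become `u v` and `0`, and `f_i` becomes
`∂/∂x_i - ξ_i` on the polynomial ring `ℂ[x, ξ]`. The `MZ_{0,-1}` property therefore makes the sum of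
the images of these commuting operators a Mathieu subspace of `ℂ[x, ξ]`. That sum is the kernel of
the evaluation `E : ξ^p x^q ↦ ∂^p x^q`.

Let `f = ∑ ξ_i H_i(x)`, where the powers of the Jacobian matrix of `H` have trace zero. Then
integration by parts gives `E(f^m) = 0` for all `m ≥ 1`, so `E(x_i f^m) = 0` for large `m` by the
Mathieu property. Since `E(g f^m) / m!` is the coefficient of `t^m` in the image of `g` under the
formal inverse of `x - t H(x)` (Abhyankar-Gurjar), that inverse is polynomial in `t`, and setting
`t = 1` inverts `x - H`.

A map with Jacobian determinant `1` is normalized to `x - H` with `H = H_2 + ⋯ + H_{d+2}`, `H_k`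
homogeneous of degree `k`. A companion-matrix stabilization in `d + 1` times as many variables makes
the Jacobian matrix nilpotent: evaluated at `t x`, the determinant of `1 - JH` becomes the reverse
characteristic polynomial of the larger Jacobian matrix. Surjectivity descends from the stabilized
map, and surjective endomorphisms of Noetherian rings are bijective.
-/

namespace JacobianConjecture

section Mathieu

variable {R A B : Type*} [CommSemiring R] [CommSemiring A] [Algebra R A] [CommSemiring B]
  [Algebra R B]

/-- Mathieu (or Mathieu-Zhao) subspaces of a commutative algebra: if all positive powers of `f` lie
in `M`, then so do almost all `g * f ^ m`, for every `g`. -/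
def IsMathieuSubspace (M : Submodule R A) : Prop :=
  ∀ f : A, (∀ m : ℕ, f ^ (m + 1) ∈ M) → ∀ g : A, ∃ N : ℕ, ∀ m ≥ N, g * f ^ m ∈ M

theorem IsMathieuSubspace.comap {M : Submodule R B} (hM : IsMathieuSubspace M) (φ : A →ₐ[R] B) :
    IsMathieuSubspace (M.comap φ.toLinearMap) := by
  intro f hf g
  obtain ⟨N, hN⟩ := hM (φ f) (fun m => by simpa using hf m) (φ g)
  exact ⟨N, fun m hm => by simpa using hN m hm⟩

end Mathieu

section ImageOfOperators

open MvPolynomial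

variable {σ τ R : Type*}

theorem pderiv_comm [CommRing R] (i j : σ) (p : MvPolynomial σ R) :
    pderiv i (pderiv j p) = pderiv j (pderiv i p) := by
  classical
  have h : ⁅pderiv (R := R) i, pderiv (R := R) j⁆ = 0 := by
    refine derivation_ext fun k => ?_
    rw [Derivation.commutator_apply]
    simp [pderiv_X, Pi.single_apply, apply_ite]
  rw [← sub_eq_zero, ← Derivation.commutator_apply, h, Derivation.zero_apply]

theorem pderiv_inr_rename_inl [CommSemiring R] (i : τ) (g : MvPolynomial σ R) :
    pderiv (Sum.inr i) (rename (Sum.inl : σ → σ ⊕ τ) g) = 0 := by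
  classical
  refine pderiv_eq_zero_of_notMem_vars fun hi => ?_
  simpa using vars_rename _ _ hi

/-- The evaluation `R[x, ξ] → R[x]`, `ξ^p x^q ↦ ∂^p x^q`, where `x i` is `X (Sum.inl i)` and `ξ i`
is `X (Sum.inr i)`. -/
noncomputable def imageEval (σ R : Type*) [Fintype σ] [CommSemiring R] :
    MvPolynomial (σ ⊕ σ) R →ₗ[R] MvPolynomial σ R :=
  (basisMonomials (σ ⊕ σ) R).constr R fun s =>
    ∏ i, Polynomial.aeval (X i)
      (Polynomial.derivative^[s (Sum.inr i)] (Polynomial.X ^ s (Sum.inl i) : Polynomial R))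

theorem imageEval_monomial [Fintype σ] [CommSemiring R] (s : σ ⊕ σ →₀ ℕ) (a : R) :
    imageEval σ R (monomial s a) = a • ∏ i, Polynomial.aeval (X i)
      (Polynomial.derivative^[s (Sum.inr i)] (Polynomial.X ^ s (Sum.inl i) : Polynomial R)) := by
  have h : monomial s a = a • basisMonomials (σ ⊕ σ) R s := by simp [smul_monomial]
  rw [h, map_smul, imageEval, Module.Basis.constr_basis]

theorem imageEval_rename_inl [Fintype σ] [CommSemiring R] (g : MvPolynomial σ R) :
    imageEval σ R (rename Sum.inl g) = g := by
  induction g using MvPolynomial.induction_on' with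
  | monomial s a =>
    have hinl (i : σ) : s.mapDomain (Sum.inl : σ → σ ⊕ σ) (Sum.inl i) = s i :=
      Finsupp.mapDomain_apply Sum.inl_injective _ _
    have hinr (i : σ) : s.mapDomain (Sum.inl : σ → σ ⊕ σ) (Sum.inr i) = 0 :=
      Finsupp.mapDomain_of_notMem_range _ _ (by simp)
    rw [rename_monomial, imageEval_monomial, monomial_eq, Finsupp.prod_fintype _ _ (by simp)]
    simp [hinl, hinr, smul_eq_C_mul]
  | add p q hp hq => rw [map_add, map_add, hp, hq]

theorem imageEval_X_inr_mul [Fintype σ] [CommSemiring R] (i : σ) (w : MvPolynomial (σ ⊕ σ) R) :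
    imageEval σ R (X (Sum.inr i) * w) = imageEval σ R (pderiv (Sum.inl i) w) := by
  classical
  induction w using MvPolynomial.induction_on' with
  | add p q hp hq => rw [mul_add, map_add, map_add, map_add, hp, hq]
  | monomial s a =>
    rw [X, monomial_mul, one_mul, pderiv_monomial, imageEval_monomial, imageEval_monomial,
      mul_smul, ← Finset.mul_prod_erase _ _ (Finset.mem_univ i),
      ← Finset.mul_prod_erase _ _ (Finset.mem_univ i), ← smul_mul_assoc (s (Sum.inl i) : R)]
    congr 2
    · simp [add_comm 1, Polynomial.derivative_X_pow, smul_eq_C_mul]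
    · refine Finset.prod_congr rfl fun j hj => ?_
      simp [(Finset.ne_of_mem_erase hj).symm]

/-- Induction on the degree in `ξ`; the step from `∂v/∂x i` to `ξ i * v` is the rule by which
`imageEval` trades a factor `ξ i` for a derivative. -/
theorem induction_on_inr [Finite σ] [CommSemiring R] {P : MvPolynomial (σ ⊕ σ) R → Prop}
    (w : MvPolynomial (σ ⊕ σ) R) (rename_inl : ∀ g, P (rename Sum.inl g))
    (add : ∀ p q, P p → P q → P (p + q))
    (X_inr_mul : ∀ i v, P (pderiv (Sum.inl i) v) → P (X (Sum.inr i) * v)) : P w := by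
  classical
  cases nonempty_fintype σ
  suffices hmon : ∀ (n : ℕ) (s : σ ⊕ σ →₀ ℕ) (a : R), ∑ i, s (Sum.inr i) = n → P (monomial s a) by
    induction w using MvPolynomial.induction_on' with
    | monomial s a => exact hmon _ s a rfl
    | add p q hp hq => exact add p q hp hq
  intro n
  induction n with
  | zero =>
    intro s a hs
    have hvars : ↑(monomial s a).vars ⊆ Set.range (Sum.inl : σ → σ ⊕ σ) := by
      rintro (i | i) hi
      · exact ⟨i, rfl⟩
      · obtain ⟨d, hd, hdi⟩ := (mem_vars_iff_mem_support _).1 hi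
        obtain rfl := Finset.mem_singleton.1 (support_monomial_subset hd)
        simp_all
    obtain ⟨g, hg⟩ := exists_rename_eq_of_vars_subset_range _ _ Sum.inl_injective hvars
    exact hg ▸ rename_inl g
  | succ n ih =>
    intro s a hs
    obtain ⟨i, hi⟩ : ∃ i, s (Sum.inr i) ≠ 0 := by
      by_contra! h
      simp [h] at hs
    obtain ⟨t, rfl⟩ : ∃ t, s = Finsupp.single (Sum.inr i) 1 + t :=
      exists_add_of_le (Finsupp.single_le_iff.2 (Nat.one_le_iff_ne_zero.2 hi))
    have ht : ∑ j, t (Sum.inr j) = n := by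
      simpa [Finset.sum_add_distrib, Finsupp.single_apply, add_comm 1] using hs
    rw [← one_mul a, ← monomial_mul]
    refine X_inr_mul i _ ?_
    rw [pderiv_monomial]
    exact ih _ _ (by simpa using ht)

theorem imageEval_X_inl_mul [Fintype σ] [CommRing R] (i : σ) (w : MvPolynomial (σ ⊕ σ) R) :
    imageEval σ R (X (Sum.inl i) * w) =
      X i * imageEval σ R w + imageEval σ R (pderiv (Sum.inr i) w) := by
  classical
  induction w using induction_on_inr with
  | rename_inl g =>
    rw [pderiv_inr_rename_inl, map_zero, add_zero, ← rename_X, ← map_mul, imageEval_rename_inl,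
      imageEval_rename_inl]
  | add p q hp hq => simp only [mul_add, map_add, hp, hq]; ring
  | X_inr_mul j v hv =>
    rw [mul_left_comm, imageEval_X_inr_mul, imageEval_X_inr_mul, pderiv_mul, pderiv_mul, map_add,
      map_add, hv, pderiv_comm (Sum.inr i), imageEval_X_inr_mul]
    simp only [pderiv_X, Pi.single_apply, Sum.inl.injEq, Sum.inr.injEq]
    rw [@eq_comm _ i j]
    ring

section imageOp

variable [CommRing R]

/-- The operator `∂/∂x i - ξ i` on `R[x, ξ]`. -/
noncomputable def imageOp (R : Type*) [CommRing R] (i : σ) :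
    Module.End R (MvPolynomial (σ ⊕ σ) R) :=
  (pderiv (Sum.inl i)).toLinearMap - LinearMap.mulLeft R (X (Sum.inr i))

/-- The sum of the images of the operators `∂/∂x i - ξ i` on `R[x, ξ]`. -/
noncomputable def opImage (σ R : Type*) [CommRing R] : Submodule R (MvPolynomial (σ ⊕ σ) R) :=
  ⨆ i, LinearMap.range (imageOp R i)

theorem imageOp_apply (i : σ) (w : MvPolynomial (σ ⊕ σ) R) :
    imageOp R i w = pderiv (Sum.inl i) w - X (Sum.inr i) * w := rfl

theorem imageOp_mem_opImage (i : σ) (w : MvPolynomial (σ ⊕ σ) R) :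
    imageOp R i w ∈ opImage σ R :=
  Submodule.mem_iSup_of_mem i ⟨w, rfl⟩

theorem sub_rename_imageEval_mem_opImage [Fintype σ] (w : MvPolynomial (σ ⊕ σ) R) :
    w - rename Sum.inl (imageEval σ R w) ∈ opImage σ R := by
  induction w using induction_on_inr with
  | rename_inl g => simp [imageEval_rename_inl]
  | add p q hp hq => simpa only [map_add, add_sub_add_comm] using add_mem hp hq
  | X_inr_mul i v hv =>
    have h := sub_mem hv (imageOp_mem_opImage i v)
    rw [imageOp_apply, ← imageEval_X_inr_mul] at h
    convert h using 1
    ring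

theorem ker_imageEval [Fintype σ] : LinearMap.ker (imageEval σ R) = opImage σ R := by
  refine le_antisymm (fun w hw => ?_) (iSup_le fun i => ?_)
  · simpa [LinearMap.mem_ker.1 hw] using sub_rename_imageEval_mem_opImage w
  · rintro _ ⟨v, rfl⟩
    rw [LinearMap.mem_ker, imageOp_apply, map_sub, imageEval_X_inr_mul, sub_self]

theorem rename_imageOp {e : σ → τ} (he : Function.Injective e) (i : σ)
    (w : MvPolynomial (σ ⊕ σ) R) :
    rename (Sum.map e e) (imageOp R i w) = imageOp R (e i) (rename (Sum.map e e) w) := by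
  simp only [imageOp_apply, map_sub, map_mul, rename_X, Sum.map_inr]
  rw [← Sum.map_inl e e, pderiv_rename (he.sumMap he)]

theorem opImage_le_comap_rename {e : σ → τ} (he : Function.Injective e) :
    opImage σ R ≤ (opImage τ R).comap (rename (Sum.map e e)).toLinearMap := by
  refine iSup_le fun i => ?_
  rintro _ ⟨v, rfl⟩
  simpa [rename_imageOp he] using imageOp_mem_opImage (e i) (rename (Sum.map e e) v)

theorem opImage_eq_comap_rename (e : σ ≃ τ) :
    opImage σ R = (opImage τ R).comap (rename (Sum.map e e)).toLinearMap := by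
  refine le_antisymm (opImage_le_comap_rename e.injective) fun w hw => ?_
  simpa [rename_rename, Sum.map_comp_map] using opImage_le_comap_rename e.symm.injective hw

theorem isMathieuSubspace_opImage_of_equiv (e : σ ≃ τ) (h : IsMathieuSubspace (opImage τ R)) :
    IsMathieuSubspace (opImage σ R) := by
  rw [opImage_eq_comap_rename e]
  exact h.comap _

end imageOp

end ImageOfOperators

section Divergence

open MvPolynomial

variable {σ R A : Type*}

instance isAddTorsionFree_mvPolynomial [CommSemiring R] [IsAddTorsionFree R] :
    IsAddTorsionFree (MvPolynomial σ R) where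
  nsmul_right_injective n hn p q hpq := by
    ext s
    exact nsmul_right_injective hn (by simpa only [coeff_smul] using congrArg (coeff s) hpq)

/-- The Jacobian matrix `(∂(H i)/∂x j)` of a polynomial map `H`. -/
noncomputable def polyJacobian [CommSemiring R] (H : σ → MvPolynomial σ R) :
    Matrix σ σ (MvPolynomial σ R) :=
  Matrix.of fun i j => pderiv j (H i)

variable [Fintype σ] [CommRing R] [CommRing A] [Algebra R A]

theorem map_derivation_mul (D : Derivation R A A) (M N : Matrix σ σ A) :
    (M * N).map D = M.map D * N + M * N.map D := by
  ext i j
  simp only [Matrix.map_apply, Matrix.mul_apply, Matrix.add_apply, map_sum, Derivation.leibniz,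
    smul_eq_mul, ← Finset.sum_add_distrib]
  exact Finset.sum_congr rfl fun k _ => by ring

variable [DecidableEq σ]

theorem trace_pow_mul_map_derivation_pow_succ (D : Derivation R A A) (N : Matrix σ σ A)
    (a b : ℕ) :
    (N ^ a * (N ^ (b + 1)).map D).trace = (b + 1) • (N ^ (a + b) * N.map D).trace := by
  induction b generalizing a with
  | zero => simp
  | succ b ih =>
    rw [pow_succ N (b + 1), map_derivation_mul, mul_add, Matrix.trace_add, ← mul_assoc,
      Matrix.trace_mul_comm, ← mul_assoc, ← pow_succ', ih, ← mul_assoc, ← pow_add,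
      add_right_comm a 1 b, add_assoc a b 1, succ_nsmul _ (b + 1)]

theorem trace_pow_mul_map_derivation_eq_zero [IsAddTorsionFree A] (D : Derivation R A A)
    {N : Matrix σ σ A} (hN : ∀ k : ℕ, (N ^ (k + 1)).trace = 0) (s : ℕ) :
    (N ^ s * N.map D).trace = 0 := by
  have h : (s + 1) • (N ^ s * N.map D).trace = 0 := calc
    _ = ((N ^ (s + 1)).map D).trace := by
      simpa using (trace_pow_mul_map_derivation_pow_succ D N 0 s).symm
    _ = D (N ^ (s + 1)).trace := by simp [Matrix.trace]
    _ = 0 := by rw [hN, map_zero]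
  exact (nsmul_eq_zero_iff_right s.succ_ne_zero).1 h

theorem sum_pderiv_polyJacobian_pow_eq_zero [IsAddTorsionFree R] {H : σ → MvPolynomial σ R}
    (hN : ∀ k : ℕ, (polyJacobian H ^ (k + 1)).trace = 0) (r : ℕ) (k : σ) :
    ∑ i, pderiv i ((polyJacobian H ^ r) i k) = 0 := by
  induction r generalizing k with
  | zero =>
    refine Finset.sum_eq_zero fun i _ => ?_
    rw [pow_zero, Matrix.one_apply]
    split_ifs <;> simp
  | succ r ih =>
    have hsymm (i l : σ) : pderiv i (polyJacobian H l k) = pderiv k (polyJacobian H l i) :=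
      pderiv_comm i k (H l)
    have htrace : ∑ i, ∑ l, (polyJacobian H ^ r) i l * pderiv i (polyJacobian H l k) = 0 := by
      simpa [hsymm, Matrix.trace, Matrix.mul_apply] using
        trace_pow_mul_map_derivation_eq_zero (pderiv (R := R) k) hN r
    simp only [pow_succ, Matrix.mul_apply, map_sum, pderiv_mul, Finset.sum_add_distrib, htrace,
      add_zero]
    rw [Finset.sum_comm]
    simp only [← Finset.sum_mul, ih, zero_mul, Finset.sum_const_zero]

theorem sum_pderiv_polyJacobian_pow_mulVec_eq_zero [IsAddTorsionFree R]
    {H : σ → MvPolynomial σ R} (hN : ∀ k : ℕ, (polyJacobian H ^ (k + 1)).trace = 0) (r : ℕ) :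
    ∑ i, pderiv i ((polyJacobian H ^ r).mulVec H i) = 0 := by
  have htrace : ∑ i, ∑ k, (polyJacobian H ^ r) i k * pderiv i (H k) = 0 := by
    rw [← hN r, Matrix.trace]
    simp only [Matrix.diag_apply, pow_succ, Matrix.mul_apply]
    rfl
  simp only [Matrix.mulVec, dotProduct, map_sum, pderiv_mul, Finset.sum_add_distrib, htrace,
    add_zero]
  rw [Finset.sum_comm]
  simp only [← Finset.sum_mul, sum_pderiv_polyJacobian_pow_eq_zero hN, zero_mul,
    Finset.sum_const_zero]

end Divergence

section Vanishing

open MvPolynomial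

variable {σ R : Type*} [Fintype σ]

/-- The polynomial `∑ ξ i * a i(x)` in `R[x, ξ]`. -/
noncomputable def xiDot [CommSemiring R] (a : σ → MvPolynomial σ R) : MvPolynomial (σ ⊕ σ) R :=
  ∑ i, X (Sum.inr i) * rename Sum.inl (a i)

theorem pderiv_inl_xiDot [CommSemiring R] (a : σ → MvPolynomial σ R) (i : σ) :
    pderiv (Sum.inl i) (xiDot a) = xiDot fun k => pderiv i (a k) := by
  simp [xiDot, pderiv_rename Sum.inl_injective, pderiv_X_of_ne]

theorem pderiv_inr_xiDot [CommSemiring R] (a : σ → MvPolynomial σ R) (i : σ) :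
    pderiv (Sum.inr i) (xiDot a) = rename Sum.inl (a i) := by
  classical
  simp [xiDot, pderiv_inr_rename_inl, pderiv_X, Pi.single_apply]

theorem imageEval_mul_xiDot [CommSemiring R] (p : MvPolynomial (σ ⊕ σ) R)
    (a : σ → MvPolynomial σ R) :
    imageEval σ R (p * xiDot a) =
      imageEval σ R (∑ i, pderiv (Sum.inl i) (p * rename Sum.inl (a i))) := by
  simp only [xiDot, Finset.mul_sum, mul_left_comm p, map_sum, imageEval_X_inr_mul]

theorem sum_xiDot_pderiv_mul_rename [CommSemiring R] (H a : σ → MvPolynomial σ R) :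
    ∑ i, xiDot (fun k => pderiv i (H k)) * rename Sum.inl (a i) =
      xiDot ((polyJacobian H).mulVec a) := by
  simp only [xiDot, Finset.sum_mul, Matrix.mulVec, dotProduct, map_sum, Finset.mul_sum, map_mul,
    polyJacobian, Matrix.of_apply, mul_assoc]
  exact Finset.sum_comm

theorem imageEval_xiDot_pow_mul_xiDot [CommSemiring R] (H a : σ → MvPolynomial σ R) (m : ℕ) :
    imageEval σ R (xiDot H ^ m * xiDot a) =
      m • imageEval σ R (xiDot H ^ (m - 1) * xiDot ((polyJacobian H).mulVec a)) +
      imageEval σ R (xiDot H ^ m * rename Sum.inl (∑ i, pderiv i (a i))) := by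
  rw [imageEval_mul_xiDot, ← map_nsmul, ← map_add, ← sum_xiDot_pderiv_mul_rename,
    map_sum (rename Sum.inl), Finset.mul_sum, Finset.mul_sum, Finset.smul_sum,
    ← Finset.sum_add_distrib]
  congr 1
  refine Finset.sum_congr rfl fun i _ => ?_
  rw [pderiv_mul, pderiv_pow, pderiv_inl_xiDot, pderiv_rename Sum.inl_injective, nsmul_eq_mul]
  ring

theorem imageEval_xiDot_pow_succ_eq_zero [CommRing R] [IsAddTorsionFree R] [DecidableEq σ]
    {H : σ → MvPolynomial σ R} (hN : ∀ k : ℕ, (polyJacobian H ^ (k + 1)).trace = 0) (m : ℕ) :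
    imageEval σ R (xiDot H ^ (m + 1)) = 0 := by
  suffices h : ∀ r, imageEval σ R (xiDot H ^ m * xiDot ((polyJacobian H ^ r).mulVec H)) = 0 by
    simpa [pow_succ] using h 0
  induction m with
  | zero =>
    intro r
    rw [imageEval_xiDot_pow_mul_xiDot, sum_pderiv_polyJacobian_pow_mulVec_eq_zero hN]
    simp
  | succ m ih =>
    intro r
    rw [imageEval_xiDot_pow_mul_xiDot, sum_pderiv_polyJacobian_pow_mulVec_eq_zero hN,
      Matrix.mulVec_mulVec, ← pow_succ', Nat.add_sub_cancel, ih]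
    simp

end Vanishing

section Inversion

open MvPolynomial

variable {σ R : Type*}

theorem surjective_of_X_mem_range {A B : Type*} [CommSemiring R] [Semiring A] [Semiring B]
    [Algebra R A] [Algebra R B] (φ : A →ₐ[R] B) {ψ : MvPolynomial σ R →ₐ[R] B}
    (hψ : Function.Surjective ψ) (h : ∀ i, ψ (X i) ∈ φ.range) : Function.Surjective φ := by
  rw [← AlgHom.range_eq_top, eq_top_iff, ← (AlgHom.range_eq_top ψ).2 hψ, ← Algebra.map_top,
    ← adjoin_range_X, AlgHom.map_adjoin, Algebra.adjoin_le_iff]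
  rintro _ ⟨_, ⟨i, rfl⟩, rfl⟩
  exact h i

/-- The comorphism `x i ↦ x i - t * H i` of the one-parameter deformation joining the identity to
`x - H`. -/
noncomputable def deformation [CommRing R] (H : σ → MvPolynomial σ R) :
    MvPolynomial σ R →ₐ[R] Polynomial (MvPolynomial σ R) :=
  aeval fun i => Polynomial.C (X i) - Polynomial.X * Polynomial.C (H i)

theorem eval_one_deformation [CommRing R] (H : σ → MvPolynomial σ R) (g : MvPolynomial σ R) :
    (deformation H g).eval 1 = aeval (fun i => X i - H i) g := by
  change (Polynomial.aeval (1 : MvPolynomial σ R)).restrictScalars R (deformation H g) = _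
  rw [← AlgHom.comp_apply]
  congr 1
  ext i
  simp [deformation]

theorem eval_one_eval₂_deformation [CommRing R] (H : σ → MvPolynomial σ R)
    (G : Polynomial (MvPolynomial σ R)) :
    (G.eval₂ (deformation H).toRingHom Polynomial.X).eval 1 =
      aeval (fun i => X i - H i) (G.eval 1) := by
  induction G using Polynomial.induction_on' with
  | add p q hp hq => simp only [Polynomial.eval₂_add, Polynomial.eval_add, map_add, hp, hq]
  | monomial n a => simp [Polynomial.eval₂_monomial, eval_one_deformation]

variable [Fintype σ] [CommRing R] [Algebra ℚ R]

/-- The series `exp (t * f)` over `R[x, ξ]`, where `f = ∑ ξ i * H i`. -/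
noncomputable def expXiDot (H : σ → MvPolynomial σ R) :
    PowerSeries (MvPolynomial (σ ⊕ σ) R) :=
  PowerSeries.rescale (xiDot H) (PowerSeries.exp _)

theorem coeff_expXiDot (H : σ → MvPolynomial σ R) (m : ℕ) :
    PowerSeries.coeff m (expXiDot H) = (1 / m.factorial : ℚ) • xiDot H ^ m := by
  rw [expXiDot, PowerSeries.coeff_rescale, PowerSeries.coeff_exp, mul_comm, ← Algebra.smul_def]

theorem pderiv_inr_coeff_expXiDot (H : σ → MvPolynomial σ R) (i : σ) (m : ℕ) :
    pderiv (Sum.inr i) (PowerSeries.coeff m (expXiDot H)) =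
      PowerSeries.coeff m
        (PowerSeries.X * PowerSeries.C (rename Sum.inl (H i)) * expXiDot H) := by
  rw [mul_assoc, coeff_expXiDot, map_rat_smul, pderiv_pow, pderiv_inr_xiDot]
  cases m with
  | zero => simp
  | succ m =>
    have hfac : (1 / m.factorial : ℚ) = 1 / (m + 1).factorial * (m + 1 : ℕ) := by
      rw [Nat.factorial_succ]
      push_cast
      field_simp
    rw [PowerSeries.coeff_succ_X_mul, PowerSeries.coeff_C_mul, coeff_expXiDot, hfac, mul_smul,
      Nat.cast_smul_eq_nsmul, mul_smul_comm, Nat.add_sub_cancel, nsmul_eq_mul]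
    congr 1
    ring

/-- The map `P(t) ↦ E(P(t) * exp (t * f))` for `f = ∑ ξ i * H i`, where `E = imageEval` acts
coefficientwise; it transports substitution along `deformation H` to plain multiplication. -/
noncomputable def inversionMap (H : σ → MvPolynomial σ R) :
    PowerSeries (MvPolynomial σ R) →+ PowerSeries (MvPolynomial σ R) where
  toFun P := PowerSeries.mk fun m => imageEval σ R
    (PowerSeries.coeff m (PowerSeries.map (rename Sum.inl).toRingHom P * expXiDot H))
  map_zero' := by ext1 m; simp
  map_add' P Q := by ext1 m; simp [add_mul]

theorem coeff_inversionMap (H : σ → MvPolynomial σ R) (P : PowerSeries (MvPolynomial σ R))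
    (m : ℕ) :
    PowerSeries.coeff m (inversionMap H P) = imageEval σ R
      (PowerSeries.coeff m (PowerSeries.map (rename Sum.inl).toRingHom P * expXiDot H)) := by
  simp [inversionMap]

theorem coeff_inversionMap_C (H : σ → MvPolynomial σ R) (a : MvPolynomial σ R) (m : ℕ) :
    PowerSeries.coeff m (inversionMap H (PowerSeries.C a)) =
      (1 / m.factorial : ℚ) • imageEval σ R (rename Sum.inl a * xiDot H ^ m) := by
  rw [coeff_inversionMap, PowerSeries.map_C, PowerSeries.coeff_C_mul, coeff_expXiDot,
    mul_smul_comm, map_rat_smul]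
  rfl

theorem inversionMap_one {H : σ → MvPolynomial σ R}
    (hH : ∀ m : ℕ, imageEval σ R (xiDot H ^ (m + 1)) = 0) : inversionMap H 1 = 1 := by
  ext1 m
  rw [← map_one PowerSeries.C, coeff_inversionMap_C, map_one, one_mul, map_one,
    PowerSeries.coeff_one]
  cases m with
  | zero => simpa using imageEval_rename_inl (1 : MvPolynomial σ R)
  | succ m => rw [hH, smul_zero, if_neg m.succ_ne_zero]

theorem inversionMap_X_mul (H : σ → MvPolynomial σ R) (P : PowerSeries (MvPolynomial σ R)) :
    inversionMap H (PowerSeries.X * P) = PowerSeries.X * inversionMap H P := by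
  ext1 m
  rw [coeff_inversionMap, map_mul (PowerSeries.map _), PowerSeries.map_X, mul_assoc]
  cases m with
  | zero => simp
  | succ m => rw [PowerSeries.coeff_succ_X_mul, PowerSeries.coeff_succ_X_mul, coeff_inversionMap]

theorem inversionMap_C_X_mul (H : σ → MvPolynomial σ R) (i : σ)
    (P : PowerSeries (MvPolynomial σ R)) :
    inversionMap H (PowerSeries.C (X i) * P) = PowerSeries.C (X i) * inversionMap H P +
      inversionMap H (PowerSeries.X * PowerSeries.C (H i) * P) := by
  set ren := PowerSeries.map (rename Sum.inl : _ →ₐ[R] MvPolynomial (σ ⊕ σ) R).toRingHom with hren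
  have hpderiv (m : ℕ) : pderiv (Sum.inr i) (PowerSeries.coeff m (ren P * expXiDot H)) =
      PowerSeries.coeff m (ren (PowerSeries.X * PowerSeries.C (H i) * P) * expXiDot H) := by
    have hmul : ren (PowerSeries.X * PowerSeries.C (H i) * P) * expXiDot H =
        ren P * (PowerSeries.X * PowerSeries.C (rename Sum.inl (H i)) * expXiDot H) := by
      have hC : ren (PowerSeries.C (H i)) = PowerSeries.C (rename Sum.inl (H i)) :=
        PowerSeries.map_C _ _
      rw [map_mul ren, map_mul ren, hC, PowerSeries.map_X, mul_comm _ (ren P), mul_assoc]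
    rw [hmul, PowerSeries.coeff_mul, PowerSeries.coeff_mul, map_sum]
    refine Finset.sum_congr rfl fun jk _ => ?_
    rw [pderiv_mul, hren, PowerSeries.coeff_map, AlgHom.toRingHom_eq_coe, RingHom.coe_coe,
      pderiv_inr_rename_inl, zero_mul, zero_add, pderiv_inr_coeff_expXiDot]
  ext1 m
  rw [map_add, PowerSeries.coeff_C_mul, coeff_inversionMap, coeff_inversionMap,
    coeff_inversionMap, ← hren, ← hpderiv, ← imageEval_X_inl_mul, map_mul ren, mul_assoc, hren,
    PowerSeries.map_C, PowerSeries.coeff_C_mul]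
  simp

theorem inversionMap_deformation_mul (H : σ → MvPolynomial σ R) (g : MvPolynomial σ R)
    (P : PowerSeries (MvPolynomial σ R)) :
    inversionMap H (deformation H g * P) = PowerSeries.C g * inversionMap H P := by
  induction g using MvPolynomial.induction_on generalizing P with
  | C a =>
    have hC : (deformation H (C a) : PowerSeries (MvPolynomial σ R)) = PowerSeries.C (C a) := by
      rw [← algebraMap_eq, AlgHom.commutes, Polynomial.algebraMap_apply, Polynomial.coe_C]
    ext1 m
    rw [hC, PowerSeries.coeff_C_mul, coeff_inversionMap, coeff_inversionMap,
      map_mul (PowerSeries.map _), PowerSeries.map_C, mul_assoc, PowerSeries.coeff_C_mul]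
    simp [← smul_eq_C_mul]
  | add p q hp hq => simp only [map_add, Polynomial.coe_add, add_mul, hp, hq]
  | mul_X p i hp =>
    rw [map_mul (deformation H), Polynomial.coe_mul, mul_assoc, hp, deformation, aeval_X,
      Polynomial.coe_sub, Polynomial.coe_mul, Polynomial.coe_C, Polynomial.coe_C, Polynomial.coe_X,
      sub_mul, map_sub, inversionMap_C_X_mul, add_sub_cancel_right, map_mul, mul_assoc]

theorem inversionMap_injective (H : σ → MvPolynomial σ R) :
    Function.Injective (inversionMap H) := by
  refine (injective_iff_map_eq_zero _).2 fun P hP => ?_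
  ext1 m
  induction m using Nat.strong_induction_on with
  | _ m ih =>
    have h : PowerSeries.coeff m (inversionMap H P) = PowerSeries.coeff m P := by
      rw [coeff_inversionMap, PowerSeries.coeff_mul, Finset.sum_eq_single (m, 0)]
      · simp [coeff_expXiDot, imageEval_rename_inl]
      · rintro ⟨j, k⟩ hjk hne
        have hj : j < m := by
          have hk : k ≠ 0 := by rintro rfl; simp_all
          have := Finset.HasAntidiagonal.mem_antidiagonal.1 hjk
          lia
        simp [ih j hj]
      · simp
    rw [← h, hP]

theorem inversionMap_eval₂_deformation {H : σ → MvPolynomial σ R} (hone : inversionMap H 1 = 1)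
    (G : Polynomial (MvPolynomial σ R)) :
    inversionMap H (G.eval₂ (deformation H).toRingHom Polynomial.X : Polynomial _) = G := by
  induction G using Polynomial.induction_on' with
  | add p q hp hq =>
    rw [Polynomial.eval₂_add, Polynomial.coe_add, map_add, hp, hq, Polynomial.coe_add]
  | monomial n a =>
    have hpow : inversionMap H (PowerSeries.X ^ n) = PowerSeries.X ^ n := by
      induction n with
      | zero => simpa using hone
      | succ n ih => rw [pow_succ', inversionMap_X_mul, ih]
    rw [Polynomial.eval₂_monomial, Polynomial.coe_mul, Polynomial.coe_pow, Polynomial.coe_X,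
      AlgHom.toRingHom_eq_coe, RingHom.coe_coe, inversionMap_deformation_mul, hpow,
      ← Polynomial.C_mul_X_pow_eq_monomial, Polynomial.coe_mul, Polynomial.coe_pow,
      Polynomial.coe_X, Polynomial.coe_C]

theorem exists_coe_eq_inversionMap_C (hσ : IsMathieuSubspace (opImage σ R))
    {H : σ → MvPolynomial σ R} (hH : ∀ m : ℕ, imageEval σ R (xiDot H ^ (m + 1)) = 0)
    (a : MvPolynomial σ R) : ∃ G : Polynomial (MvPolynomial σ R),
      (G : PowerSeries (MvPolynomial σ R)) = inversionMap H (PowerSeries.C a) := by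
  rw [← ker_imageEval] at hσ
  obtain ⟨N, hN⟩ := hσ _ hH (rename Sum.inl a)
  refine ⟨PowerSeries.trunc N (inversionMap H (PowerSeries.C a)), ?_⟩
  ext1 m
  rw [Polynomial.coeff_coe, PowerSeries.coeff_trunc]
  split_ifs with hm
  · rfl
  · rw [coeff_inversionMap_C, LinearMap.mem_ker.1 (hN m (not_lt.1 hm)), smul_zero]

theorem surjective_aeval_X_sub [DecidableEq σ] (hσ : IsMathieuSubspace (opImage σ R))
    {H : σ → MvPolynomial σ R} (hN : ∀ k : ℕ, (polyJacobian H ^ (k + 1)).trace = 0) :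
    Function.Surjective (aeval (R := R) fun i => X i - H i :
      MvPolynomial σ R → MvPolynomial σ R) := by
  have := IsAddTorsionFree.of_module_rat R
  have hH := imageEval_xiDot_pow_succ_eq_zero hN
  refine surjective_of_X_mem_range _ (ψ := AlgHom.id R _) Function.surjective_id fun i => ?_
  obtain ⟨G, hG⟩ := exists_coe_eq_inversionMap_C hσ hH (X i)
  have hinv : G.eval₂ (deformation H).toRingHom Polynomial.X = Polynomial.C (X i) := by
    refine Polynomial.coe_injective _ (inversionMap_injective H ?_)
    rw [inversionMap_eval₂_deformation (inversionMap_one hH), hG, Polynomial.coe_C]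
  have hX := eval_one_eval₂_deformation H G
  rw [hinv, Polynomial.eval_C] at hX
  exact ⟨G.eval 1, hX.symm⟩

end Inversion

section Companion

open scoped Kronecker

variable {σ A : Type*} [CommRing A] {d : ℕ}

/-- The square matrix of size `d + 1` with ones just above the diagonal and zeros elsewhere. -/
def superdiagonal (A : Type*) [CommRing A] (d : ℕ) : Matrix (Fin (d + 1)) (Fin (d + 1)) A :=
  Matrix.of fun k l => if (l : ℕ) = k + 1 then 1 else 0

theorem det_one_sub_smul_superdiagonal (t : A) : (1 - t • superdiagonal A d).det = 1 := by
  rw [Matrix.det_of_isUpperTriangular]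
  · simp [superdiagonal]
  · intro k l hlk
    have hne : (l : ℕ) ≠ k + 1 := by have : (l : ℕ) < k := hlk; lia
    simp [superdiagonal, hne, (show l < k from hlk).ne']

theorem sum_pow_mul_one_sub_smul_superdiagonal (t : A) (l : Fin (d + 1)) :
    ∑ k : Fin (d + 1), t ^ (k : ℕ) * (1 - t • superdiagonal A d) k l = if l = 0 then 1 else 0 := by
  simp only [Matrix.sub_apply, mul_sub, Finset.sum_sub_distrib, Matrix.one_apply, superdiagonal,
    Matrix.smul_apply, Matrix.of_apply, smul_eq_mul, mul_ite, mul_one, mul_zero]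
  cases l using Fin.cases with
  | zero => simp
  | succ l =>
    have hl (k : Fin (d + 1)) : (l : ℕ) = k ↔ k = l.castSucc := by simp [Fin.ext_iff, eq_comm]
    simp [hl, pow_succ]

/-- The block companion matrix with blocks `b 0, …, b d` in its first block column and identity
blocks just above the diagonal. -/
def blockCompanion [DecidableEq σ] (b : Fin (d + 1) → Matrix σ σ A) :
    Matrix (σ × Fin (d + 1)) (σ × Fin (d + 1)) A :=
  (Matrix.of fun p q => if q.2 = 0 then b p.2 p.1 q.1 else 0) + 1 ⊗ₖ superdiagonal A d

variable [Fintype σ] [DecidableEq σ]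

theorem det_one_sub_smul_blockCompanion (t : A) (b : Fin (d + 1) → Matrix σ σ A) :
    (1 - t • blockCompanion b).det = (1 - ∑ k : Fin (d + 1), t ^ (k + 1 : ℕ) • b k).det := by
  set S : Matrix (σ × Fin (d + 1)) (σ × Fin (d + 1)) A := 1 ⊗ₖ (1 - t • superdiagonal A d) with hS
  set B : Matrix (σ × Fin (d + 1)) σ A := Matrix.of fun p j => t * b p.2 p.1 j with hB
  set V : Matrix σ (σ × Fin (d + 1)) A :=
    Matrix.of fun i q => if i = q.1 then t ^ (q.2 : ℕ) else 0 with hV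
  have hVS : V * S = Matrix.of fun i q => if i = q.1 ∧ q.2 = 0 then 1 else 0 := by
    ext i ⟨j, l⟩
    simp only [hV, hS, Matrix.mul_apply, Fintype.sum_prod_type, Matrix.of_apply,
      Matrix.kroneckerMap_apply, Matrix.one_apply, ite_mul, one_mul, zero_mul, mul_ite, mul_zero]
    rw [Finset.sum_eq_single i (by intro k _ hk; simp [hk.symm]) (by simp)]
    by_cases hij : i = j <;> simp only [hij, if_true, if_false, Finset.sum_const_zero,
      sum_pow_mul_one_sub_smul_superdiagonal, true_and, false_and]
  have hfactor : 1 - t • blockCompanion b = (1 - B * V) * S := by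
    have hBE : B * V * S =
        t • Matrix.of fun p q : σ × Fin (d + 1) => if q.2 = 0 then b p.2 p.1 q.1 else 0 := by
      ext p q
      rw [Matrix.mul_assoc, hVS]
      by_cases hq : q.2 = 0 <;> simp [hB, hq, Matrix.mul_apply]
    have hS' : S = 1 - t • (1 : Matrix σ σ A) ⊗ₖ superdiagonal A d := by
      rw [hS, eq_sub_iff_add_eq, ← Matrix.kronecker_smul, ← Matrix.kronecker_add, sub_add_cancel,
        Matrix.one_kronecker_one]
    rw [Matrix.sub_mul, Matrix.one_mul, hBE, hS', blockCompanion, smul_add,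
      sub_add_eq_sub_sub_swap]
  have hVB : V * B = ∑ k : Fin (d + 1), t ^ (k + 1 : ℕ) • b k := by
    ext i j
    simp [hV, hB, Matrix.mul_apply, Fintype.sum_prod_type, Matrix.sum_apply, pow_succ, mul_assoc]
  rw [hfactor, Matrix.det_mul, Matrix.det_one_sub_mul_comm, hVB, hS, Matrix.det_kronecker,
    det_one_sub_smul_superdiagonal, Matrix.det_one, one_pow, one_pow, mul_one, mul_one]

theorem charpolyRev_blockCompanion (b : Fin (d + 1) → Matrix σ σ A) :
    (blockCompanion b).charpolyRev =
      (1 - ∑ k : Fin (d + 1), (Polynomial.X : Polynomial A) ^ (k + 1 : ℕ) •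
        (b k).map Polynomial.C).det := by
  have hmap : (blockCompanion b).map Polynomial.C =
      blockCompanion fun k => (b k).map Polynomial.C := by
    ext p q : 1
    simp [blockCompanion, superdiagonal, Matrix.one_apply, apply_ite Polynomial.C]
  rw [Matrix.charpolyRev, hmap, det_one_sub_smul_blockCompanion]

theorem isNilpotent_of_charpolyRev_eq_one {N : Matrix σ σ A} (h : N.charpolyRev = 1) :
    IsNilpotent N := by
  have hX : N.charpoly = Polynomial.X ^ N.charpoly.natDegree := by
    rw [← Polynomial.reflect_one, ← h, ← Matrix.reverse_charpoly, Polynomial.reverse,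
      Polynomial.reflect_reflect]
  refine ⟨N.charpoly.natDegree, ?_⟩
  simpa [← hX, Matrix.aeval_self_charpoly] using
    (map_pow (Polynomial.aeval N) (Polynomial.X : Polynomial A) N.charpoly.natDegree).symm

end Companion

section CompanionMap

open MvPolynomial

open scoped Kronecker

variable {σ R : Type*} [CommRing R] {d : ℕ}

/-- The polynomial map `(x_0, …, x_d) ↦ (K_k(x_0) + x_{k+1})_{0 ≤ k ≤ d}`, where `x_{d+1} = 0`. -/
noncomputable def companionMap (K : σ → Fin (d + 1) → MvPolynomial σ R) (p : σ × Fin (d + 1)) :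
    MvPolynomial (σ × Fin (d + 1)) R :=
  rename (·, 0) (K p.1 p.2) + ∑ l : Fin (d + 1), if (l : ℕ) = p.2 + 1 then X (p.1, l) else 0

theorem polyJacobian_companionMap [DecidableEq σ] (K : σ → Fin (d + 1) → MvPolynomial σ R) :
    polyJacobian (companionMap K) =
      blockCompanion fun k => (polyJacobian fun i => K i k).map (rename (·, 0)) := by
  ext ⟨i, k⟩ ⟨j, l⟩ : 2
  have hK : pderiv (j, l) (rename (·, (0 : Fin (d + 1))) (K i k)) =
      if l = 0 then rename (·, 0) (pderiv j (K i k)) else 0 := by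
    split_ifs with hl
    · subst hl
      exact pderiv_rename (Prod.mk_left_injective 0) _ _
    · refine pderiv_eq_zero_of_notMem_vars fun h => hl ?_
      obtain ⟨_, -, h0⟩ := Finset.mem_image.1 (vars_rename _ _ h)
      exact (congrArg Prod.snd h0).symm
  have hX (m : Fin (d + 1)) : pderiv (R := R) (j, l) (if (m : ℕ) = k + 1 then X (i, m) else 0) =
      if m = l then (if (l : ℕ) = k + 1 then if i = j then 1 else 0 else 0) else 0 := by
    by_cases hm : m = l
    · subst hm
      by_cases hij : i = j <;> by_cases hk : (m : ℕ) = k + 1 <;>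
        simp [hij, hk, pderiv_X]
    · simp [hm, apply_ite (pderiv (j, l)), pderiv_X]
  simp only [polyJacobian, companionMap, blockCompanion, Matrix.of_apply, map_add, Matrix.map_apply,
    Matrix.add_apply, hK, map_sum, hX]
  simp [superdiagonal, Matrix.one_apply]

theorem aeval_mul_of_isHomogeneous {R A : Type*} [CommSemiring R] [CommSemiring A] [Algebra R A]
    {p : MvPolynomial σ R} {m : ℕ} (hp : p.IsHomogeneous m) (t : A) (g : σ → A) :
    aeval (fun i => t * g i) p = t ^ m * aeval g p := by
  simp only [aeval_def, eval₂_eq, Finset.mul_sum]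
  refine Finset.sum_congr rfl fun s hs => ?_
  rw [mul_left_comm, hp.degree_eq_sum_deg_support hs]
  simp only [mul_pow, Finset.prod_mul_distrib, Finset.prod_pow_eq_pow_sum]

theorem charpolyRev_polyJacobian_companionMap [Fintype σ] [DecidableEq σ]
    {K : σ → Fin (d + 1) → MvPolynomial σ R} (hK : ∀ i k, (K i k).IsHomogeneous (k + 2)) :
    (polyJacobian (companionMap K)).charpolyRev =
      aeval (fun i => Polynomial.X * Polynomial.C (X (i, 0)))
        (1 - polyJacobian fun i => ∑ k, K i k).det := by
  have hC (p : MvPolynomial σ R) : aeval (fun i => Polynomial.C (X (i, (0 : Fin (d + 1))))) p =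
      Polynomial.C (rename (R := R) (·, (0 : Fin (d + 1))) p) := by
    induction p using MvPolynomial.induction_on with
    | C a => simp [← algebraMap_eq, Polynomial.algebraMap_apply]
    | add p q hp hq => simp only [map_add, hp, hq]
    | mul_X p i hp => simp only [map_mul, aeval_X, rename_X, hp]
  rw [polyJacobian_companionMap, charpolyRev_blockCompanion, AlgHom.map_det, map_sub, map_one]
  congr 2
  ext i j : 1
  simp only [Matrix.sum_apply, AlgHom.mapMatrix_apply, Matrix.map_apply, polyJacobian,
    Matrix.of_apply, map_sum, Matrix.smul_apply, smul_eq_mul]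
  refine Finset.sum_congr rfl fun k _ => ?_
  rw [aeval_mul_of_isHomogeneous (hK i k).pderiv, hC]
  rfl

theorem sum_Ici_eq_add_sum_succ {M : Type*} [AddCommMonoid M] (f : Fin (d + 1) → M)
    (k : Fin (d + 1)) :
    ∑ l ∈ Finset.Ici k, f l =
      f k + ∑ l : Fin (d + 1), if (l : ℕ) = k + 1 then ∑ m ∈ Finset.Ici l, f m else 0 := by
  rw [← Finset.Ioi_insert, Finset.sum_insert Finset.notMem_Ioi_self]
  congr 1
  cases k using Fin.lastCases with
  | last =>
    rw [Finset.sum_eq_zero fun l _ => if_neg l.isLt.ne]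
    simp [← Fin.top_eq_last]
  | cast k =>
    have hl (l : Fin (d + 1)) : (l : ℕ) = k.castSucc + 1 ↔ l = k.succ := by simp [Fin.ext_iff]
    simp only [hl, Finset.sum_ite_eq', Finset.mem_univ, if_true]
    congr 1
    ext l
    simp [Fin.lt_def, Fin.le_def]

/-- The retraction `x_k ↦ ∑_{l ≥ k} K_l(x_0)` for `k ≥ 1`, `x_0 ↦ x_0`; it kills the components
`k ≥ 1` of the map `x - companionMap K`. -/
noncomputable def companionRetraction (K : σ → Fin (d + 1) → MvPolynomial σ R) :
    MvPolynomial (σ × Fin (d + 1)) R →ₐ[R] MvPolynomial σ R :=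
  aeval fun p => if p.2 = 0 then X p.1 else ∑ l ∈ Finset.Ici p.2, K p.1 l

theorem companionRetraction_rename (K : σ → Fin (d + 1) → MvPolynomial σ R)
    (g : MvPolynomial σ R) : companionRetraction K (rename (·, 0) g) = g := by
  rw [companionRetraction, aeval_rename]
  exact aeval_X_left_apply g

theorem companionRetraction_companionMap (K : σ → Fin (d + 1) → MvPolynomial σ R)
    (p : σ × Fin (d + 1)) :
    companionRetraction K (companionMap K p) = ∑ l ∈ Finset.Ici p.2, K p.1 l := by
  rw [companionMap, map_add, companionRetraction_rename, sum_Ici_eq_add_sum_succ, map_sum]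
  congr 1
  refine Finset.sum_congr rfl fun l _ => ?_
  split_ifs with hl
  · have hl0 : l ≠ 0 := by rintro rfl; simp at hl
    rw [companionRetraction, aeval_X, if_neg hl0]
  · exact map_zero _

theorem surjective_aeval_X_sub_sum_of_companionMap {K : σ → Fin (d + 1) → MvPolynomial σ R}
    (hK : Function.Surjective (aeval (R := R) fun p => X p - companionMap K p :
      MvPolynomial (σ × Fin (d + 1)) R → MvPolynomial (σ × Fin (d + 1)) R)) :
    Function.Surjective (aeval (R := R) fun i => X i - ∑ k, K i k :
      MvPolynomial σ R → MvPolynomial σ R) := by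
  have hretraction : Function.Surjective (companionRetraction K) :=
    Function.RightInverse.surjective (companionRetraction_rename K)
  refine surjective_of_X_mem_range _
    (ψ := (companionRetraction K).comp (aeval fun p => X p - companionMap K p))
    (by rw [AlgHom.coe_comp]; exact hretraction.comp hK) fun ⟨j, k⟩ => ?_
  rw [AlgHom.comp_apply, aeval_X, map_sub, companionRetraction_companionMap, companionRetraction,
    aeval_X]
  split_ifs with hk
  · refine ⟨X j, ?_⟩
    obtain rfl : k = 0 := hk
    simp [← bot_eq_zero]
  · rw [sub_self]
    exact zero_mem _

theorem surjective_aeval_X_sub_of_det_eq_one [Algebra ℚ R] [IsReduced R] [Fintype σ]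
    [DecidableEq σ] (hσ : IsMathieuSubspace (opImage (σ × Fin (d + 1)) R))
    {K : σ → Fin (d + 1) → MvPolynomial σ R} (hK : ∀ i k, (K i k).IsHomogeneous (k + 2))
    (hdet : (1 - polyJacobian fun i => ∑ k, K i k).det = 1) :
    Function.Surjective (aeval (R := R) fun i => X i - ∑ k, K i k :
      MvPolynomial σ R → MvPolynomial σ R) := by
  have hN : IsNilpotent (polyJacobian (companionMap K)) :=
    isNilpotent_of_charpolyRev_eq_one <| by
      rw [charpolyRev_polyJacobian_companionMap hK, hdet, map_one]
  exact surjective_aeval_X_sub_sum_of_companionMap <| surjective_aeval_X_sub hσ fun k =>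
    (Matrix.isNilpotent_trace_of_isNilpotent (hN.pow_succ k)).eq_zero

end CompanionMap

section Normalization

open MvPolynomial

variable {σ R : Type*} [CommRing R]

theorem bijective_of_surjective_of_isNoetherianRing [IsNoetherianRing R] (f : R →+* R)
    (hf : Function.Surjective f) : Function.Bijective f := by
  refine ⟨(injective_iff_map_eq_zero f).2 fun x hx => ?_, hf⟩
  let kers : ℕ →o Ideal R := ⟨fun n => RingHom.ker (f ^ n), monotone_nat_of_le_succ fun n y hy => by
    rw [RingHom.mem_ker] at hy ⊢
    rw [pow_succ', RingHom.mul_def, RingHom.comp_apply, hy, map_zero]⟩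
  obtain ⟨n, hn⟩ := monotone_stabilizes_iff_noetherian.2 inferInstance kers
  obtain ⟨y, rfl⟩ : ∃ y, (f ^ n) y = x := by
    rw [RingHom.coe_pow]
    exact hf.iterate n x
  have hy : y ∈ kers (n + 1) := by
    change (f ^ (n + 1)) y = 0
    rw [pow_succ', RingHom.mul_def, RingHom.comp_apply, hx]
  rw [← hn (n + 1) n.le_succ] at hy
  exact hy

theorem eq_sum_homogeneousComponent_add_two {p : MvPolynomial σ R} {d : ℕ}
    (hd : p.totalDegree ≤ d + 2) (h0 : constantCoeff p = 0)
    (h1 : ∀ j, constantCoeff (pderiv j p) = 0) :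
    p = ∑ k : Fin (d + 1), homogeneousComponent (k + 2) p := by
  have hc0 : homogeneousComponent 0 p = 0 := by
    rw [homogeneousComponent_zero, ← constantCoeff_eq, h0, map_zero]
  have hc1 : homogeneousComponent 1 p = 0 := by
    refine homogeneousComponent_eq_zero' _ _ fun s hs hdeg => ?_
    obtain ⟨j, rfl⟩ := (Finsupp.sum_eq_one_iff s).1 hdeg
    refine mem_support_iff.1 hs ?_
    simpa [constantCoeff_eq, coeff_pderiv] using h1 j
  have hsum : ∑ k ∈ Finset.range (d + 3), homogeneousComponent k p = p := by
    conv_rhs => rw [← sum_homogeneousComponent p]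
    refine (Finset.sum_subset (Finset.range_mono (by lia)) fun k _ hk => ?_).symm
    exact homogeneousComponent_eq_zero _ _ (by simpa using hk)
  rw [Finset.sum_range_succ', Finset.sum_range_succ', hc0, zero_add, hc1, add_zero, add_zero,
    Finset.sum_range] at hsum
  exact hsum.symm

theorem polyJacobian_X_sub [DecidableEq σ] (G : σ → MvPolynomial σ R) :
    polyJacobian (fun i => X i - G i) = 1 - polyJacobian G := by
  ext1 i j
  simp [polyJacobian, Matrix.one_apply, pderiv_X, Pi.single_apply]

theorem exists_eq_sum_isHomogeneous [Finite σ] {H : σ → MvPolynomial σ R}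
    (h0 : ∀ i, constantCoeff (H i) = 0) (h1 : (polyJacobian H).map constantCoeff = 0) :
    ∃ (d : ℕ) (K : σ → Fin (d + 1) → MvPolynomial σ R),
      (∀ i k, (K i k).IsHomogeneous (k + 2)) ∧ ∀ i, H i = ∑ k, K i k := by
  cases nonempty_fintype σ
  refine ⟨Finset.univ.sup fun i => (H i).totalDegree,
    fun i k => homogeneousComponent (k + 2) (H i),
    fun i k => homogeneousComponent_isHomogeneous _ _,
    fun i => eq_sum_homogeneousComponent_add_two ?_ (h0 i) fun j => congrFun (congrFun h1 i) j⟩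
  exact (Finset.le_sup (f := fun i => (H i).totalDegree) (Finset.mem_univ i)).trans (by lia)

variable [Fintype σ] [DecidableEq σ]

theorem surjective_aeval_of_map_constantCoeff_eq_one [Algebra ℚ R] [IsReduced R]
    (hσ : ∀ d : ℕ, IsMathieuSubspace (opImage (σ × Fin (d + 1)) R)) {G : σ → MvPolynomial σ R}
    (h0 : ∀ i, constantCoeff (G i) = 0) (h1 : (polyJacobian G).map constantCoeff = 1)
    (hdet : (polyJacobian G).det = 1) :
    Function.Surjective (aeval (R := R) G : MvPolynomial σ R → MvPolynomial σ R) := by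
  obtain ⟨d, K, hhom, hK⟩ := exists_eq_sum_isHomogeneous (H := fun i => X i - G i)
    (fun i => by rw [map_sub, constantCoeff_X, h0, sub_zero])
    (by rw [polyJacobian_X_sub, Matrix.map_sub _ (map_sub _), h1,
      Matrix.map_one _ (map_zero _) (map_one _), sub_self])
  have hG : G = fun i => X i - ∑ k, K i k := funext fun i => by rw [← hK i, sub_sub_cancel]
  have hJ : (1 - polyJacobian fun i => ∑ k, K i k).det = 1 := by
    simp only [← hK]
    rw [polyJacobian_X_sub, sub_sub_cancel, hdet]
  rw [hG]
  exact surjective_aeval_X_sub_of_det_eq_one (hσ d) hhom hJ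

/-- The polynomial map `F` composed with the affine map that turns its linearization at `0` into the
identity. -/
noncomputable def linearNormalization (F : σ → MvPolynomial σ R) (i : σ) : MvPolynomial σ R :=
  ∑ j, C (((polyJacobian F).map constantCoeff)⁻¹ i j) * (F j - C (constantCoeff (F j)))

theorem constantCoeff_linearNormalization (F : σ → MvPolynomial σ R) (i : σ) :
    constantCoeff (linearNormalization F i) = 0 := by
  simp [linearNormalization]

theorem polyJacobian_linearNormalization (F : σ → MvPolynomial σ R) :
    polyJacobian (linearNormalization F) =
      (((polyJacobian F).map constantCoeff)⁻¹).map C * polyJacobian F := by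
  ext1 i j
  simp [polyJacobian, linearNormalization, Matrix.mul_apply]

theorem det_map_constantCoeff_polyJacobian {F : σ → MvPolynomial σ R}
    (hF : (polyJacobian F).det = 1) : ((polyJacobian F).map constantCoeff).det = 1 := by
  rw [← RingHom.mapMatrix_apply, ← RingHom.map_det, hF, map_one]

theorem map_constantCoeff_polyJacobian_linearNormalization {F : σ → MvPolynomial σ R}
    (hF : (polyJacobian F).det = 1) :
    (polyJacobian (linearNormalization F)).map constantCoeff = 1 := by
  have hC (M : Matrix σ σ R) : (M.map (C (σ := σ))).map constantCoeff = M := by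
    ext i j
    simp
  rw [polyJacobian_linearNormalization, Matrix.map_mul, hC, Matrix.nonsing_inv_mul]
  rw [det_map_constantCoeff_polyJacobian hF]
  exact isUnit_one

theorem det_polyJacobian_linearNormalization {F : σ → MvPolynomial σ R}
    (hF : (polyJacobian F).det = 1) : (polyJacobian (linearNormalization F)).det = 1 := by
  rw [polyJacobian_linearNormalization, Matrix.det_mul, hF, mul_one, ← RingHom.mapMatrix_apply,
    ← RingHom.map_det, Matrix.det_nonsing_inv, det_map_constantCoeff_polyJacobian hF,
    Ring.inverse_one, map_one]

theorem linearNormalization_mem (S : Subalgebra R (MvPolynomial σ R)) {F : σ → MvPolynomial σ R}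
    (hF : ∀ i, F i ∈ S) (i : σ) : linearNormalization F i ∈ S :=
  sum_mem fun j _ => mul_mem (S.algebraMap_mem _) (sub_mem (hF j) (S.algebraMap_mem _))

theorem surjective_of_det_polyJacobian_eq_one [Algebra ℚ R] [IsReduced R]
    (hσ : ∀ d : ℕ, IsMathieuSubspace (opImage (σ × Fin (d + 1)) R))
    {φ : MvPolynomial σ R →ₐ[R] MvPolynomial σ R}
    (hφ : (polyJacobian fun i => φ (X i)).det = 1) : Function.Surjective φ := by
  have hsurj := surjective_aeval_of_map_constantCoeff_eq_one hσ
    (constantCoeff_linearNormalization fun i => φ (X i))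
    (map_constantCoeff_polyJacobian_linearNormalization hφ)
    (det_polyJacobian_linearNormalization hφ)
  refine surjective_of_X_mem_range φ hsurj fun i => ?_
  rw [aeval_X]
  exact linearNormalization_mem φ.range (fun j => ⟨X j, rfl⟩) i

theorem bijective_of_det_polyJacobian_eq_one [IsNoetherianRing R] [Algebra ℚ R] [IsReduced R]
    (hσ : ∀ d : ℕ, IsMathieuSubspace (opImage (σ × Fin (d + 1)) R))
    {φ : MvPolynomial σ R →ₐ[R] MvPolynomial σ R}
    (hφ : (polyJacobian fun i => φ (X i)).det = 1) : Function.Bijective φ :=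
  bijective_of_surjective_of_isNoetherianRing φ.toRingHom
    (surjective_of_det_polyJacobian_eq_one hσ hφ)

end Normalization

section VertexAlgebra

open MZVertex

variable {V A : Type*} [AddCommGroup V] [Module ℂ V] [CommSemiring A] [Algebra ℂ A]
  {Y : V →ₗ[ℂ] VertexOperator ℂ V} {π : V →ₗ[ℂ] A}

theorem map_iterProd (hneg_one : ∀ u v, π (nthMode Y u (-1) v) = π u * π v)
    (hzero : ∀ u v, π (nthMode Y u 0 v) = 0) (v : V) {L : List ℤ} (hL : IsZeroNegOne L) :
    π (iterProd Y v L) = if 0 ∈ L then 0 else π v ^ (L.length + 1) := by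
  induction L with
  | nil => simp [iterProd]
  | cons n L ih =>
    have hcons : iterProd Y v (n :: L) = nthMode Y v n (iterProd Y v L) := rfl
    have ih := ih fun k hk => hL k (List.mem_cons_of_mem n hk)
    obtain rfl | rfl := hL n List.mem_cons_self
    · simp [hcons, hzero]
    · simp [hcons, hneg_one, ih, pow_succ']

theorem isMathieuSubspace_of_isMZSubspace_comap (hπ : Function.Surjective π)
    (hneg_one : ∀ u v, π (nthMode Y u (-1) v) = π u * π v)
    (hzero : ∀ u v, π (nthMode Y u 0 v) = 0) {M : Submodule ℂ A}
    (hM : IsMZSubspace Y (M.comap π)) : IsMathieuSubspace M := by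
  intro f hf g
  obtain ⟨v, rfl⟩ := hπ f
  obtain ⟨b, rfl⟩ := hπ g
  have hv : v ∈ radical Y (M.comap π) := by
    refine ⟨0, fun L hL _ => ?_⟩
    rw [Submodule.mem_comap, map_iterProd hneg_one hzero v hL]
    split_ifs
    · exact zero_mem M
    · exact hf _
  rw [hM] at hv
  obtain ⟨N, hN⟩ := hv.1 b
  refine ⟨N + 1, fun m hm => ?_⟩
  obtain ⟨t, rfl⟩ : ∃ t, m = t + 1 := ⟨m - 1, by lia⟩
  have hL : IsZeroNegOne (List.replicate t (-1)) := fun k hk => Or.inr (List.eq_of_mem_replicate hk)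
  have hmem := hN _ hL (by simpa using hm) (-1) (Or.inr rfl)
  rw [Submodule.mem_comap, hneg_one, map_iterProd hneg_one hzero v hL] at hmem
  simpa using hmem

end VertexAlgebra

section Heisenberg

open MvPolynomial MZVertex Heisenberg

variable {ι : Type*}

/-- The projection of `M(1)` onto its `C₂`-algebra `M(1) / C₂(M(1))`, a polynomial ring in which
`X i` is the class of `h_i(-1) 𝟏`. -/
noncomputable def cTwoProj (ι : Type*) : Fock ι →ₐ[ℂ] MvPolynomial ι ℂ :=
  aeval fun q => if q.2 = 1 then X q.1 else 0

theorem cTwoProj_X (q : ι × ℕ+) : cTwoProj ι (X q) = if q.2 = 1 then X q.1 else 0 :=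
  aeval_X _ q

theorem cTwoProj_rename (g : MvPolynomial ι ℂ) : cTwoProj ι (rename (·, 1) g) = g := by
  rw [cTwoProj, aeval_rename]
  exact aeval_X_left_apply g

theorem cTwoProj_surjective : Function.Surjective (cTwoProj ι) :=
  Function.RightInverse.surjective cTwoProj_rename

theorem cTwoProj_pderiv (i : ι) (w : Fock ι) :
    cTwoProj ι (pderiv (i, 1) w) = pderiv i (cTwoProj ι w) := by
  classical
  induction w using MvPolynomial.induction_on with
  | C a => simp [← algebraMap_eq]
  | add p q hp hq => simp only [map_add, hp, hq]
  | mul_X p q hp =>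
    have hX : cTwoProj ι (pderiv (i, 1) (X q)) = pderiv i (cTwoProj ι (X q)) := by
      obtain ⟨j, n⟩ := q
      by_cases hn : n = 1
      · by_cases hij : j = i <;> simp [cTwoProj_X, hn, pderiv_X, hij]
      · simp [cTwoProj_X, hn, pderiv_X]
    simp only [pderiv_mul, map_add, map_mul, hp, hX]

theorem mode_negSucc (i : ι) (k : ℕ) (w : Fock ι) :
    mode i (Int.negSucc k) w = X (i, k.succPNat) * w := rfl

theorem cTwoProj_prod_mode {L : List (ι × ℤ)} (hL : ∀ a ∈ L, a.2 < 0) (w : Fock ι) :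
    cTwoProj ι ((L.map fun a => mode a.1 a.2).prod w) =
      (L.map fun a => if a.2 = -1 then X a.1 else 0).prod * cTwoProj ι w := by
  induction L with
  | nil => simp
  | cons a L ih =>
    obtain ⟨i, m⟩ := a
    obtain ⟨k, rfl⟩ := Int.eq_negSucc_of_lt_zero (hL _ List.mem_cons_self)
    have hk : k.succPNat = 1 ↔ Int.negSucc k = -1 := by simp [← PNat.coe_inj, Int.negSucc_eq]
    simp only [List.map_cons, List.prod_cons, Module.End.mul_apply, mode_negSucc, map_mul,
      ih fun a ha => hL a (List.mem_cons_of_mem _ ha), cTwoProj_X, hk, mul_assoc]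

theorem cTwoProj_normalOrder_eq_zero {L : List (ι × ℤ)} (hL : ∃ a ∈ L, a.2 < -1) (w : Fock ι) :
    cTwoProj ι (normalOrder L w) = 0 := by
  obtain ⟨a, ha, hlt⟩ := hL
  rw [normalOrder, List.map_append, List.prod_append, Module.End.mul_apply,
    cTwoProj_prod_mode (by simp), List.prod_eq_zero, zero_mul]
  have hneg : a.2 < 0 := by lia
  exact List.mem_map.2 ⟨a, List.mem_filter.2 ⟨ha, decide_eq_true hneg⟩, if_neg hlt.ne⟩

theorem normalOrder_of_forall_neg {L : List (ι × ℤ)} (hL : ∀ a ∈ L, a.2 < 0) :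
    normalOrder L = (L.map fun a => mode a.1 a.2).prod := by
  have h1 : L.filter (fun a => a.2 < 0) = L := List.filter_eq_self.2 (by simpa using hL)
  have h2 : L.filter (fun a => 0 ≤ a.2) = [] := List.filter_eq_nil_iff.2 (by simpa using hL)
  rw [normalOrder, h1, h2, List.append_nil]

theorem normalOrder_eq_zero_of_mem {L : List (ι × ℤ)} {i : ι} (hi : (i, 0) ∈ L) :
    normalOrder L = 0 :=
  List.prod_eq_zero (List.mem_map.2 ⟨(i, 0), by simp [hi], rfl⟩)

theorem fieldCoeff_neg_one (n : ℕ+) : fieldCoeff n (-1) = if n = 1 then 1 else 0 := by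
  have hn : n.natPred = 0 ↔ n = 1 := PNat.natPred_inj (n := 1)
  simp [fieldCoeff, Ring.choose_zero_ite, hn]

/-- Modes below `-1` are killed by the projection, and a positive mode would make the degree of the
term in `z` smaller than `-1`. -/
theorem cTwoProj_fieldTerm_eq_zero {l : List (ι × ℕ+)} {m : Fin l.length → ℤ}
    (hdeg : -1 ≤ ∑ j, (-m j - ((l.get j).2 : ℤ))) (hm : m ≠ fun _ => -1) (w : Fock ι) :
    cTwoProj ι (fieldTerm l m w) = 0 := by
  by_contra hne
  have hmem (j) : ((l.get j).1, m j) ∈ List.ofFn fun j => ((l.get j).1, m j) :=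
    List.mem_ofFn.2 ⟨j, rfl⟩
  have hlow (j) : -1 ≤ m j := by
    by_contra! hj
    refine hne ?_
    rw [fieldTerm, LinearMap.smul_apply, map_smul,
      cTwoProj_normalOrder_eq_zero ⟨_, hmem j, hj⟩, smul_zero]
  have hzero (j) : m j ≠ 0 := fun hj => hne <| by
    rw [fieldTerm, normalOrder_eq_zero_of_mem (hj ▸ hmem j), smul_zero, LinearMap.zero_apply,
      map_zero]
  have hneg (j) (hj : m j < 0) : m j ≤ -((l.get j).2 : ℤ) := by
    obtain ⟨N, hN⟩ := exists_bound w
    exact (fieldTerm_ne_zero hN (fun h => hne (by rw [h, map_zero])) j).2 hj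
  obtain ⟨i, hi⟩ := Function.ne_iff.1 hm
  have hle (j) : -m j - ((l.get j).2 : ℤ) ≤ if j = i then -2 else 0 := by
    specialize hlow j
    specialize hzero j
    specialize hneg j
    have hpos := (l.get j).2.pos
    split_ifs with hji
    · subst hji
      lia
    · lia
  have hsum := hdeg.trans (Finset.sum_le_sum fun j _ => hle j)
  simp at hsum

theorem cTwoProj_fieldTerm_neg_one (l : List (ι × ℕ+)) (w : Fock ι) :
    cTwoProj ι (fieldTerm l (fun _ => -1) w) = cTwoProj ι ((l.map X).prod * w) := by
  have hneg : ∀ a ∈ List.ofFn fun j => ((l.get j).1, (-1 : ℤ)), a.2 < 0 := by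
    intro a ha
    obtain ⟨j, rfl⟩ := List.mem_ofFn.1 ha
    simp
  rw [fieldTerm, normalOrder_of_forall_neg hneg, LinearMap.smul_apply, map_smul,
    cTwoProj_prod_mode hneg, map_mul, ← smul_mul_assoc]
  congr 1
  have hprod : (l.map X).prod = ∏ j, (X (l.get j) : Fock ι) := by
    conv_lhs => rw [← List.ofFn_get l, List.map_ofFn, List.prod_ofFn]
    rfl
  rw [List.map_ofFn, List.prod_ofFn, hprod, map_prod, ← Finset.prod_smul]
  simp [fieldCoeff_neg_one, cTwoProj_X]

theorem cTwoProj_zCoeff (l : List (ι × ℕ+)) {k : ℤ} (hk : -1 ≤ k) (w : Fock ι) :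
    cTwoProj ι (zCoeff l k w) = if k = 0 then cTwoProj ι ((l.map X).prod * w) else 0 := by
  classical
  have hterm : ∀ m ∈ modeTuples l k, cTwoProj ι (fieldTerm l m w) =
      if m = fun _ => -1 then cTwoProj ι ((l.map X).prod * w) else 0 := by
    intro m hm
    split_ifs with h
    · rw [h, cTwoProj_fieldTerm_neg_one]
    · exact cTwoProj_fieldTerm_eq_zero (hk.trans_eq hm.symm) h w
  have hfinsum : cTwoProj ι (zCoeff l k w) =
      ∑ᶠ m ∈ modeTuples l k, cTwoProj ι (fieldTerm l m w) :=
    AddMonoidHom.map_finsum_mem' (cTwoProj ι).toAddMonoidHom (finite_support l k w)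
  rw [hfinsum, finsum_mem_congr rfl hterm,
    finsum_eq_single _ (fun _ => -1) fun m hm => by simp only [hm, if_false, finsum_zero],
    if_pos rfl, finsum_eq_if]
  by_cases hl : ∀ q ∈ l, q.2 = 1
  · have hmem : (fun _ => -1) ∈ modeTuples l k ↔ k = 0 := by
      simp [modeTuples, hl, eq_comm]
    simp only [hmem]
  · push Not at hl
    obtain ⟨q, hq, hne⟩ := hl
    have hprod : cTwoProj ι (l.map X).prod = 0 := by
      rw [map_list_prod, List.map_map]
      exact List.prod_eq_zero (List.mem_map.2 ⟨q, hq, (cTwoProj_X q).trans (if_neg hne)⟩)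
    simp only [map_mul, hprod, zero_mul, ite_self]

theorem nthMode_Y_monomial (s : ι × ℕ+ →₀ ℕ) (p : ℤ) :
    nthMode (Y ι) (monomial s 1) p = zCoeff (Finsupp.toMultiset s).toList (-p - 1) := by
  have h : monomial s (1 : ℂ) = basisMonomials (ι × ℕ+) ℂ s := by simp
  rw [nthMode, h, Y, Module.Basis.constr_basis, monomialField, VertexOperator.ncoeff_of_coeff]

theorem prod_map_X_toList (s : ι × ℕ+ →₀ ℕ) :
    ((Finsupp.toMultiset s).toList.map X).prod = (monomial s 1 : Fock ι) := by
  rw [← Multiset.prod_coe, ← Multiset.map_coe, Multiset.coe_toList]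
  induction s using Finsupp.induction_linear with
  | zero => simp
  | add s t hs ht =>
    rw [map_add, Multiset.map_add, Multiset.prod_add, hs, ht, monomial_mul, one_mul]
  | single q n =>
    rw [Finsupp.toMultiset_single, Multiset.map_nsmul, Multiset.prod_nsmul, Multiset.map_singleton,
      Multiset.prod_singleton, X_pow_eq_monomial]

theorem cTwoProj_nthMode {p : ℤ} (hp : p ≤ 0) (u w : Fock ι) :
    cTwoProj ι (nthMode (Y ι) u p w) = if p = -1 then cTwoProj ι (u * w) else 0 := by
  have hadd (u v : Fock ι) : nthMode (Y ι) (u + v) p = nthMode (Y ι) u p + nthMode (Y ι) v p := by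
    simp [nthMode]
  have hsmul (a : ℂ) (u : Fock ι) : nthMode (Y ι) (a • u) p = a • nthMode (Y ι) u p := by
    simp [nthMode]
  induction u using MvPolynomial.induction_on' with
  | monomial s a =>
    have ha : monomial s a = a • (monomial s 1 : Fock ι) := by simp [smul_monomial]
    have hp' : -p - 1 = 0 ↔ p = -1 := by lia
    rw [ha, hsmul, nthMode_Y_monomial, LinearMap.smul_apply, map_smul, cTwoProj_zCoeff _ (by lia),
      prod_map_X_toList]
    simp [hp']
  | add u v hu hv =>
    rw [hadd, LinearMap.add_apply, map_add, hu, hv, add_mul, map_add]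
    split_ifs <;> simp

theorem zCoeff_singleton (i : ι) (n : ℕ+) (k : ℤ) :
    zCoeff [(i, n)] k = fieldCoeff n (-k - n) • mode i (-k - n) := by
  refine LinearMap.ext fun w => ?_
  have hmodes : modeTuples [(i, n)] k = {fun _ => -k - (n : ℤ)} := by
    ext m
    have hiff : -m 0 - (n : ℤ) = k ↔ m 0 = -k - n := by lia
    simpa [modeTuples, funext_iff, Fin.forall_fin_one] using hiff
  have horder (m : ℤ) : normalOrder [(i, m)] = mode i m := by
    rcases lt_or_ge m 0 with hm | hm
    · simp [normalOrder, hm, not_le.2 hm]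
    · simp [normalOrder, hm, not_lt.2 hm]
  change ∑ᶠ m ∈ modeTuples [(i, n)] k, fieldTerm [(i, n)] m w = _
  rw [hmodes, finsum_mem_singleton]
  simp [fieldTerm, horder]

theorem nthMode_Y_X (i : ι) (n : ℕ+) (p : ℤ) :
    nthMode (Y ι) (X (i, n)) p = fieldCoeff n (p + 1 - n) • mode i (p + 1 - n) := by
  have hk : -(-p - 1) - (n : ℤ) = p + 1 - n := by ring
  rw [X, nthMode_Y_monomial, Finsupp.toMultiset_single, one_nsmul, Multiset.toList_singleton,
    zCoeff_singleton, hk]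

theorem X_add_one_mul_mem_cTwo (i : ι) (n : ℕ+) (w : Fock ι) :
    X (i, n + 1) * w ∈ cTwo (Y ι) := by
  have h : nthMode (Y ι) (X (i, n)) (-2) w = (n : ℂ) • (X (i, n + 1) * w) := by
    obtain ⟨k, rfl⟩ : ∃ k : ℕ, n = k.succPNat := ⟨n.natPred, (PNat.succPNat_natPred n).symm⟩
    have hm : -2 + 1 - (k.succPNat : ℤ) = Int.negSucc (k + 1) := by
      rw [Nat.succPNat_coe, Int.negSucc_eq]
      lia
    have hk : -Int.negSucc (k + 1) - 1 = ((k + 1 : ℕ) : ℤ) := by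
      rw [Int.neg_negSucc]
      lia
    have hcoeff : fieldCoeff k.succPNat (Int.negSucc (k + 1)) = (k.succPNat : ℂ) := by
      rw [fieldCoeff, hk, Ring.choose_natCast]
      simp
    rw [nthMode_Y_X, hm, hcoeff]
    rfl
  have hn : (n : ℂ) ≠ 0 := Nat.cast_ne_zero.2 n.ne_zero
  refine (Submodule.smul_mem_iff _ hn).1 ?_
  rw [← h]
  exact Submodule.subset_span ⟨_, _, rfl⟩

theorem sub_rename_cTwoProj_mem_cTwo (w : Fock ι) :
    w - rename (·, 1) (cTwoProj ι w) ∈ cTwo (Y ι) := by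
  suffices h : ∀ v, (w - rename (·, 1) (cTwoProj ι w)) * v ∈ cTwo (Y ι) by simpa using h 1
  induction w using MvPolynomial.induction_on with
  | C a => simp [cTwoProj]
  | add p q hp hq =>
    intro v
    rw [map_add, map_add, ← sub_add_sub_comm, add_mul]
    exact add_mem (hp v) (hq v)
  | mul_X p q hp =>
    intro v
    obtain ⟨i, n⟩ := q
    by_cases hn : n = 1
    · rw [map_mul, map_mul, cTwoProj_X, if_pos hn, rename_X, hn, ← sub_mul, mul_assoc]
      exact hp _
    · obtain ⟨k, rfl⟩ := PNat.exists_eq_succ_of_ne_one hn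
      rw [map_mul, cTwoProj_X, if_neg hn, mul_zero, map_zero, sub_zero, mul_comm p, mul_assoc]
      exact X_add_one_mul_mem_cTwo i k _

theorem cTwo_eq_ker_cTwoProj : cTwo (Y ι) = LinearMap.ker (cTwoProj ι).toLinearMap := by
  refine le_antisymm (Submodule.span_le.2 ?_) fun w hw => ?_
  · rintro _ ⟨u, v, rfl⟩
    exact cTwoProj_nthMode (by norm_num) u v
  · have h := sub_rename_cTwoProj_mem_cTwo w
    rwa [show cTwoProj ι w = 0 from hw, map_zero, sub_zero] at h

theorem fieldCoeff_one (m : ℤ) : fieldCoeff 1 m = 1 := by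
  rw [fieldCoeff, show PNat.natPred 1 = 0 from rfl, Ring.choose_zero_right, Int.cast_one]

theorem cTwoProj_fMap {n : ℕ} (i : Fin n) (w : Fock (Fin n ⊕ Fin n)) :
    cTwoProj _ (fMap i w) = imageOp ℂ i (cTwoProj _ w) := by
  have hβ : nthMode (Y _) (gen (Sum.inl i)) 1 w = pderiv (Sum.inl i, 1) w := by
    rw [gen, nthMode_Y_X, fieldCoeff_one, one_smul]
    change (((0 : ℕ) : ℂ) + 1) • pderiv (Sum.inl i, Nat.succPNat 0) w = _
    rw [Nat.cast_zero, zero_add, one_smul]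
    rfl
  have hα : nthMode (Y _) (gen (Sum.inr i)) (-1) w = X (Sum.inr i, 1) * w := by
    rw [gen, nthMode_Y_X, fieldCoeff_one, one_smul]
    rfl
  rw [fMap, LinearMap.sub_apply, hβ, hα, map_sub, cTwoProj_pderiv, map_mul, cTwoProj_X, if_pos rfl,
    imageOp_apply]

theorem imageSubspace_eq_comap (n : ℕ) :
    imageSubspace n = (opImage (Fin n) ℂ).comap (cTwoProj (Fin n ⊕ Fin n)).toLinearMap := by
  have hcomp (i : Fin n) : (cTwoProj _).toLinearMap ∘ₗ fMap i =
      imageOp ℂ i ∘ₗ (cTwoProj _).toLinearMap := LinearMap.ext (cTwoProj_fMap i)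
  have hrange : LinearMap.range (cTwoProj (Fin n ⊕ Fin n)).toLinearMap = ⊤ :=
    LinearMap.range_eq_top.2 cTwoProj_surjective
  rw [imageSubspace, cTwo_eq_ker_cTwoProj, ← Submodule.comap_map_eq, Submodule.map_iSup, opImage]
  simp only [← LinearMap.range_comp, hcomp, LinearMap.range_comp_of_range_eq_top _ hrange]

theorem isMathieuSubspace_opImage_of_isMZSubspace {n : ℕ}
    (h : IsMZSubspace (Y (Fin n ⊕ Fin n)) (imageSubspace n)) :
    IsMathieuSubspace (opImage (Fin n) ℂ) := by
  rw [imageSubspace_eq_comap] at h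
  refine isMathieuSubspace_of_isMZSubspace_comap cTwoProj_surjective (fun u v => ?_)
    (fun u v => ?_) h
  · simpa using cTwoProj_nthMode (by norm_num : (-1 : ℤ) ≤ 0) u v
  · simpa using cTwoProj_nthMode le_rfl u v

end Heisenberg

end JacobianConjecture

theorem mainTheorem4
    (h : ∀ n : ℕ, 0 < n →
      MZVertex.IsMZSubspace (Heisenberg.Y (Fin n ⊕ Fin n)) (Heisenberg.imageSubspace n)) :
    ∀ n : ℕ, 0 < n →
      ∀ φ : MvPolynomial (Fin n) ℂ →ₐ[ℂ] MvPolynomial (Fin n) ℂ,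
        (jacobianMatrix φ).det = 1 → Function.Bijective φ := by
  intro n hn φ hφ
  refine JacobianConjecture.bijective_of_det_polyJacobian_eq_one (fun d => ?_) hφ
  exact JacobianConjecture.isMathieuSubspace_opImage_of_equiv finProdFinEquiv
    (JacobianConjecture.isMathieuSubspace_opImage_of_isMZSubspace (h _ (Nat.mul_pos hn d.succ_pos)))
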